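/- **Setting.** Let $X\subset\mathbb R^n$ be a nonempty compact convex set with diameter $D_X$, and let $f$ be differentiable on $X$ with gradient $\nabla f$ satisfying, for all $x,y\in X$, $\|\nabla f(x)-\nabla f(y)\|\le L\|x-y\|$ and $f(x)-f(y)-\langle\nabla f(y),x-y\rangle\ge-\frac l2\|x-y\|^2$, where $0\le l\le L$. Let $\xi$ be a random variable with values in $\Xi$, and let a stochastic oracle return $\mathcal F(x,\xi)\in\mathbb R$ and $\mathcal G(x,\xi)=\nabla_x\mathcal F(x,\xi)\in\mathbb R^n$ such that, for all $x,y\in X$: * $\mathbb E\,\mathcal F(x,\xi)=f(x)$, $\mathbb E\,\mathcal G(x,\xi)=\nabla f(x)$ and $\mathbb E\|\mathcal G(x,\xi)-\nabla f(x)\|^2\le\sigma^2$, where $\sigma>0$; * $\|\mathcal G(x,\xi)-\mathcal G(y,\xi)\|\le\mathcal L(\xi)\|x-y\|$ and $\mathcal F(x,\xi)-\mathcal F(y,\xi)-\langle\mathcal G(y,\xi),x-y\rangle\le\frac{\mathcal L(\xi)}2\|x-y\|^2$ for every value of $\xi$, where $\mathcal L(\xi)\ge0$, $\mathcal L(\xi)\le\hat{\mathcal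 L}$ almost surely and $\mathbb E\,\mathcal L(\xi)^2\le\bar{\mathcal L}^2$; * (light tails) $\mathbb E\exp\big(\|\mathcal G(x,\xi)-\nabla f(x)\|^2/\sigma^2\big)\le e$. Write $P_X(x,g,\gamma)=\gamma(x-x^+)$ with $x^+=\arg\min_{u\in X}\{\langle g,u\rangle+\frac\gamma2\|x-u\|^2\}$, and use the convention $0/0=0$. **AC-SPG** with $k\ge2$ iterations, $x_0\in X$ and $0<\bar{\mathcal L}_0\le\hat{\mathcal L}$. For $t=1,\dots,k$ put $\gamma_t=2\max\{\bar{\mathcal L}_0,\dots,\bar{\mathcal L}_{t-1}\}$; draw $b_t$ fresh i.i.d. samples, let $\hat G_t(x_{t-1})$ be the average of $\mathcal G(x_{t-1},\cdot)$ over them, and set $x_t=\arg\min_{x\in X}\{\langle\hat G_t(x_{t-1}),x\rangle+\frac{\gamma_t}2\|x_{t-1}-x\|^2\}$; then draw $b_t'\ge1$ further fresh i.i.d. samples, where $b'_t$ may depend on the samples drawn before them in the run, let $\bar F_t,\bar G_t$ be the averages of $\mathcal F,\mathcal G$ over them, and set $\bar{\mathcal L}_t=2\big(\bar F_t(x_t)-\bar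 F_t(x_{t-1})-\langle\bar G_t(x_{t-1}),x_t-x_{t-1}\rangle\big)/\|x_t-x_{t-1}\|^2$. The batch size is either (a) $b_t=\max\{1,\lceil\frac{(3t-1)\alpha}{2\gamma_t}\rceil\}$ with $\alpha>0$, or (b) $b_t=b\ge1$. The output is $x_R$, where, given the samples, $R=t-1$ with probability $\big(\sum_{j=2}^k\frac{j-1}{\gamma_j}\big)^{-1}\frac{t-1}{\gamma_t}$ for $t=2,\dots,k$. **2-AC-SPG.** Run $\mathcal R\ge1$ independent trials of AC-SPG, with outputs $\bar x_r=x_{R_r}$, $r=1,\dots,\mathcal R$. Draw $\mathcal K\ge1$ fresh i.i.d. samples $\xi_1,\dots,\xi_{\mathcal K}$, put $\bar g_X(\bar x_r)=P_X\big(\bar x_r,\frac1{\mathcal K}\sum_{j=1}^{\mathcal K}\mathcal G(\bar x_r,\xi_j),\gamma_{R_r+1}\big)$, where $\gamma_{R_r+1}$ is that of trial $r$, and return a candidate $\bar x\in\{\bar x_1,\dots,\bar x_{\mathcal R}\}$ for which $\|\bar g_X(\bar x)\|=\min_r\|\bar g_X(\bar x_r)\|$. Put $g_X(\bar x_r)=P_X(\bar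 x_r,\nabla f(\bar x_r),\gamma_{R_r+1})$, and let $g_X(\bar x)$ be its value for the selected trial. Let $M_k^{(r)}=\sum_{t=2}^k\frac{t-1}{4\gamma_t}$ with the $\gamma_t$ of trial $r$, let $M_k=\min_rM_k^{(r)}$, and let $$Q_k=\begin{cases}(k+1)\hat{\mathcal L}D_X^2+\frac{k\sigma^2}{\alpha}&\text{in case (a)},\\[2pt](k+1)\hat{\mathcal L}D_X^2+\frac{(3k+1)k\sigma^2}{8b\bar{\mathcal L}_0}&\text{in case (b)}.\end{cases}$$ **Claim.** 1. For every $\lambda\ge0$, with probability at least $1-2^{-\mathcal R}-\mathcal R\exp(-\lambda^2/3)$, $$\|g_X(\bar x)\|^2\le\frac{8Q_k}{M_k}+\frac{12(1+\lambda)^2\sigma^2}{\mathcal K}.$$ 2. Consequently, if $\delta\in(0,1)$ and $\mathcal R=\lceil\log_2(2/\delta)\rceil$, then with probability at least $1-\delta$, $$\|g_X(\bar x)\|^2\le\frac{8Q_k}{M_k}+12\Big(1+\sqrt{3\log\tfrac{2\lceil\log_2(2/\delta)\rceil}{\delta}}\Big)^2\frac{\sigma^2}{\mathcal K}.$$ 3.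 The post-optimization sample size required in 2. depends only logarithmically on $\delta$: there is an absolute constant $C>0$ such that, for all $\delta\in(0,\frac12]$, $\epsilon>0$ and $\sigma>0$, the second term on the right-hand side of 2. is at most $\epsilon^2$ as soon as $\mathcal K\ge C\sigma^2\log(1/\delta)/\epsilon^2$. -/

import Mathlib

open MeasureTheory ProbabilityTheory

namespace ACSPG

noncomputable section

section Prox

variable {E : Type*} [NormedAddCommGroup E] [InnerProductSpace ℝ E]

/-- The objective `⟨g, u⟩ + (γ / 2) ‖x - u‖²` of the prox-mapping. -/
def proxObjective (x g : E) (γ : ℝ) (u : E) : ℝ :=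
  inner ℝ g u + γ / 2 * ‖x - u‖ ^ 2

/-- `x⁺ = argmin_{u ∈ X} { ⟨g, u⟩ + (γ / 2) ‖x - u‖² }`. The minimizer exists and is unique when
`X` is nonempty, compact and convex and `γ > 0`. -/
def proxPoint (X : Set E) (x g : E) (γ : ℝ) : E :=
  Classical.epsilon fun u => u ∈ X ∧ IsMinOn (proxObjective x g γ) X u

/-- The projected gradient `P_X(x, g, γ) = γ (x - x⁺)`. -/
def projGrad (X : Set E) (x g : E) (γ : ℝ) : E :=
  γ • (x - proxPoint X x g γ)

/-- The mini-batch average `(1 / b) ∑_{j < b} h (s j)`. -/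
def batchMean {Ξ V : Type*} [AddCommGroup V] [Module ℝ V] (b : ℕ) (h : Ξ → V) (s : ℕ → Ξ) : V :=
  (b : ℝ)⁻¹ • ∑ j ∈ Finset.range b, h (s j)

/-- The estimate `2 (F̄(y) - F̄(x) - ⟨Ḡ(x), y - x⟩) / ‖y - x‖²` of the local smoothness constant,
from a batch of size `b` (with `0 / 0 = 0`). -/
def localSmoothness {Ξ : Type*} (F : E → Ξ → ℝ) (G : E → Ξ → E) (b : ℕ) (s : ℕ → Ξ) (x y : E) : ℝ :=
  2 * (batchMean b (F y) s - batchMean b (F x) s - inner ℝ (batchMean b (G x) s) (y - x))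
    / ‖y - x‖ ^ 2

end Prox

section Assumptions

variable {E : Type*} [NormedAddCommGroup E] [InnerProductSpace ℝ E] [CompleteSpace E]

/-- `f` is differentiable on `X` with gradient `∇f = gradf`, which is `L`-Lipschitz on `X`, and `f`
has lower curvature parameter `l ∈ [0, L]`. -/
structure IsSmoothWeaklyConvex (X : Set E) (f : E → ℝ) (gradf : E → E) (L l : ℝ) : Prop where
  hasGradient : ∀ x ∈ X, HasGradientWithinAt f (gradf x) X x
  lipschitz : ∀ x ∈ X, ∀ y ∈ X, ‖gradf x - gradf y‖ ≤ L * ‖x - y‖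
  weaklyConvex : ∀ x ∈ X, ∀ y ∈ X,
    -(l / 2) * ‖x - y‖ ^ 2 ≤ f x - f y - inner ℝ (gradf y) (x - y)
  l_nonneg : 0 ≤ l
  l_le : l ≤ L

variable {Ξ : Type*} [MeasurableSpace Ξ]

/-- Unbiasedness of the stochastic gradient. -/
structure IsUnbiased [MeasurableSpace E] (μ : Measure Ξ) (X : Set E) (G : E → Ξ → E)
    (gradf : E → E) : Prop where
  measurable : ∀ x ∈ X, Measurable (G x)
  integrable : ∀ x ∈ X, Integrable (G x) μ
  mean : ∀ x ∈ X, ∫ ξ, G x ξ ∂μ = gradf x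

/-- The variance of the stochastic gradient is at most `σ²`, with `σ > 0`. -/
structure HasBoundedVariance (μ : Measure Ξ) (X : Set E) (G : E → Ξ → E)
    (gradf : E → E) (σ : ℝ) : Prop where
  pos : 0 < σ
  integrable : ∀ x ∈ X, Integrable (fun ξ => ‖G x ξ - gradf x‖ ^ 2) μ
  variance_le : ∀ x ∈ X, ∫ ξ, ‖G x ξ - gradf x‖ ^ 2 ∂μ ≤ σ ^ 2

/-- Smoothness of the stochastic function: `F(·, ξ)` is an unbiased estimator of `f` with
gradient `G(·, ξ)`, and is smooth with a constant `ell ξ` that is almost surely at most `Lhat` and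
whose second moment is at most `Lbar²`. -/
structure IsSmoothStochastic (μ : Measure Ξ) (X : Set E) (f : E → ℝ)
    (F : E → Ξ → ℝ) (G : E → Ξ → E) (Lhat Lbar : ℝ) : Prop where
  measurable : ∀ x ∈ X, Measurable (F x)
  integrable : ∀ x ∈ X, Integrable (F x) μ
  mean : ∀ x ∈ X, ∫ ξ, F x ξ ∂μ = f x
  hasGradient : ∀ ξ, ∀ x ∈ X, HasGradientWithinAt (fun y => F y ξ) (G x ξ) X x
  smooth : ∃ ell : Ξ → ℝ, Measurable ell ∧ (∀ ξ, 0 ≤ ell ξ) ∧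
    (∀ ξ, ∀ x ∈ X, ∀ y ∈ X, ‖G x ξ - G y ξ‖ ≤ ell ξ * ‖x - y‖) ∧
    (∀ ξ, ∀ x ∈ X, ∀ y ∈ X,
      F x ξ - F y ξ - inner ℝ (G y ξ) (x - y) ≤ ell ξ / 2 * ‖x - y‖ ^ 2) ∧
    (∀ᵐ ξ ∂μ, ell ξ ≤ Lhat) ∧
    ∫ ξ, ell ξ ^ 2 ∂μ ≤ Lbar ^ 2

/-- The light-tail condition `E exp(‖G(x, ξ) - ∇f(x)‖² / σ²) ≤ e` on `X`. -/
structure HasLightTail (μ : Measure Ξ) (X : Set E) (G : E → Ξ → E)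
    (gradf : E → E) (σ : ℝ) : Prop where
  integrable : ∀ x ∈ X, Integrable (fun ξ => Real.exp (‖G x ξ - gradf x‖ ^ 2 / σ ^ 2)) μ
  mean_le : ∀ x ∈ X, ∫ ξ, Real.exp (‖G x ξ - gradf x‖ ^ 2 / σ ^ 2) ∂μ ≤ Real.exp 1

end Assumptions

section Algorithm

/-- The two rules for the batch size: `b_t = max {1, ⌈(3t - 1) α / (2 γ_t)⌉}`, or `b_t = b`. -/
inductive BatchRule where
  | adaptive (α : ℝ)
  | constant (b : ℕ)

namespace BatchRule

/-- Validity of the parameter of a rule: `α > 0`, respectively `b ≥ 1`. -/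
def Valid : BatchRule → Prop
  | adaptive α => 0 < α
  | constant b => 1 ≤ b

/-- The batch size `b_t` at iteration `t` when `γ_t = γ`. -/
def size : BatchRule → ℕ → ℝ → ℕ
  | adaptive α, t, γ => max 1 ⌈(3 * (t : ℝ) - 1) * α / (2 * γ)⌉₊
  | constant b, _, _ => b

end BatchRule

/-- The quantity `Q_k`. -/
def Q (rule : BatchRule) (k : ℕ) (Lhat D σ L₀ : ℝ) : ℝ :=
  match rule with
  | .adaptive α => ((k : ℝ) + 1) * Lhat * D ^ 2 + (k : ℝ) * σ ^ 2 / α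
  | .constant b => ((k : ℝ) + 1) * Lhat * D ^ 2
      + (3 * (k : ℝ) + 1) * (k : ℝ) * σ ^ 2 / (8 * (b : ℝ) * L₀)

/-- The input of AC-SPG: feasible set, stochastic first-order oracle, initial point, initial
smoothness estimate and batch size rule. -/
structure Input (E Ξ : Type*) where
  X : Set E
  F : E → Ξ → ℝ
  G : E → Ξ → E
  x₀ : E
  L₀ : ℝ
  rule : BatchRule

variable {E Ξ : Type*} [NormedAddCommGroup E] [InnerProductSpace ℝ E]

/-- The pair `(x_t, max {L̄₀, …, L̄_t})` after `t` iterations of AC-SPG, where `s t j` and `s' t j`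
are the samples available to the first and the second batch of iteration `t`, and `b' t` is the
size of the second batch. -/
def state (A : Input E Ξ) (s s' : ℕ → ℕ → Ξ) (b' : ℕ → ℕ) : ℕ → E × ℝ
  | 0 => (A.x₀, A.L₀)
  | t + 1 =>
    let x := (state A s s' b' t).1
    let Lmax := (state A s s' b' t).2
    let γ := 2 * Lmax
    let y := proxPoint A.X x (batchMean (A.rule.size (t + 1) γ) (A.G x) (s (t + 1))) γ
    (y, max Lmax (localSmoothness A.F A.G (b' (t + 1)) (s' (t + 1)) x y))

/-- The iterate `x_t`. -/
def iterate (A : Input E Ξ) (s s' : ℕ → ℕ → Ξ) (b' : ℕ → ℕ) (t : ℕ) : E :=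
  (state A s s' b' t).1

/-- The parameter `γ_t = 2 max {L̄₀, …, L̄_{t-1}}`, for `t ≥ 1`. -/
def gam (A : Input E Ξ) (s s' : ℕ → ℕ → Ξ) (b' : ℕ → ℕ) (t : ℕ) : ℝ :=
  2 * (state A s s' b' (t - 1)).2

/-- `M_k = ∑_{t=2}^k (t - 1) / (4 γ_t)`. -/
def M (γ : ℕ → ℝ) (k : ℕ) : ℝ :=
  ∑ t ∈ Finset.Icc 2 k, ((t : ℝ) - 1) / (4 * γ t)

/-- The probability that the output index is `i`: equal to
`(∑_{j=2}^k (j - 1) / γ_j)⁻¹ (t - 1) / γ_t` for `i = t - 1` with `2 ≤ t ≤ k`, and to `0` for all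
other `i`. -/
def outputProb (γ : ℕ → ℝ) (k i : ℕ) : ℝ :=
  if i + 1 ∈ Finset.Icc 2 k then
    (∑ j ∈ Finset.Icc 2 k, ((j : ℝ) - 1) / γ j)⁻¹ * ((i : ℝ) / γ (i + 1))
  else 0

/-- Labels of the samples of the two-phase method with `R` trials and `K` post-optimization
samples: the `j`-th sample for the first or the second batch of iteration `t` of trial `r`, and the
`j`-th post-optimization sample. -/
inductive Label (R K : ℕ) where
  | fst (r : Fin R) (t j : ℕ)
  | snd (r : Fin R) (t j : ℕ)
  | post (j : Fin K)

variable {Ω : Type*} {R K : ℕ}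

/-- The σ-algebra generated by the samples with label in `I`. -/
abbrev sampleSigma [MeasurableSpace Ξ] (S : Label R K → Ω → Ξ) (I : Set (Label R K)) :
    MeasurableSpace Ω :=
  ⨆ i ∈ I, MeasurableSpace.comap (S i) inferInstance

/-- The samples of trial `r` that precede the second batch of iteration `t`. -/
def beforeSnd (r : Fin R) (t : ℕ) : Set (Label R K) :=
  {i | (∃ u j, u ≤ t ∧ i = .fst r u j) ∨ (∃ u j, u < t ∧ i = .snd r u j)}

/-- The iterate `x_t` of trial `r`, as a random vector. -/
def trialIterate (A : Input E Ξ) (S : Label R K → Ω → Ξ) (b' : Fin R → ℕ → Ω → ℕ)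
    (r : Fin R) (t : ℕ) (ω : Ω) : E :=
  iterate A (fun u j => S (.fst r u j) ω) (fun u j => S (.snd r u j) ω) (fun u => b' r u ω) t

/-- The parameter `γ_t` of trial `r`, as a random variable. -/
def trialGam (A : Input E Ξ) (S : Label R K → Ω → Ξ) (b' : Fin R → ℕ → Ω → ℕ)
    (r : Fin R) (ω : Ω) (t : ℕ) : ℝ :=
  gam A (fun u j => S (.fst r u j) ω) (fun u j => S (.snd r u j) ω) (fun u => b' r u ω) t

/-- The candidate `x̄_r = x_{R_r}` of trial `r`, with `R_r = ρ r`. -/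
def candidate (A : Input E Ξ) (S : Label R K → Ω → Ξ) (b' : Fin R → ℕ → Ω → ℕ)
    (ρ : Fin R → Ω → ℕ) (r : Fin R) (ω : Ω) : E :=
  trialIterate A S b' r (ρ r ω) ω

/-- `g_X(x̄_r) = P_X(x̄_r, ∇f(x̄_r), γ_{R_r + 1})`. -/
def exactProjGrad (A : Input E Ξ) (gradf : E → E) (S : Label R K → Ω → Ξ)
    (b' : Fin R → ℕ → Ω → ℕ) (ρ : Fin R → Ω → ℕ) (r : Fin R) (ω : Ω) : E :=
  projGrad A.X (candidate A S b' ρ r ω) (gradf (candidate A S b' ρ r ω))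
    (trialGam A S b' r ω (ρ r ω + 1))

/-- `ḡ_X(x̄_r) = P_X(x̄_r, (1 / K) ∑_j G(x̄_r, ξ_j), γ_{R_r + 1})`, with the `K` post-optimization
samples `ξ_j`. -/
def sampledProjGrad (A : Input E Ξ) (S : Label R K → Ω → Ξ)
    (b' : Fin R → ℕ → Ω → ℕ) (ρ : Fin R → Ω → ℕ) (r : Fin R) (ω : Ω) : E :=
  projGrad A.X (candidate A S b' ρ r ω)
    ((K : ℝ)⁻¹ • ∑ j : Fin K, A.G (candidate A S b' ρ r ω) (S (.post j) ω))
    (trialGam A S b' r ω (ρ r ω + 1))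

/-- A run of the two-phase method 2-AC-SPG with `R` trials of `k` iterations and `K`
post-optimization samples. -/
structure IsTwoPhaseRun [MeasurableSpace Ξ] [MeasurableSpace Ω] (μ : Measure Ξ) (P : Measure Ω)
    (A : Input E Ξ) (k : ℕ) (S : Label R K → Ω → Ξ) (b' : Fin R → ℕ → Ω → ℕ)
    (ρ : Fin R → Ω → ℕ) (sel : Ω → Fin R) : Prop where
  /-- All samples are independent with law `μ`. -/
  sample_measurable : ∀ i, Measurable (S i)
  sample_law : ∀ i, P.map (S i) = μ
  sample_indep : iIndepFun S P
  /-- The sizes of the second batches are positive and chosen before these batches are drawn. -/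
  snd_size_pos : ∀ r t ω, 1 ≤ b' r t ω
  snd_size_measurable : ∀ r t, Measurable[sampleSigma S (beforeSnd r t)] (b' r t)
  /-- Given all samples, the output indices of the trials are drawn independently of each other,
  each of them according to the output probabilities of its trial. -/
  index_measurable : ∀ r, Measurable (ρ r)
  index_law : ∀ i : Fin R → ℕ,
    P[Set.indicator {ω | ∀ r, ρ r ω = i r} (fun _ => (1 : ℝ)) | sampleSigma S Set.univ]
      =ᵐ[P] fun ω => ∏ r, outputProb (trialGam A S b' r ω) k (i r)
  /-- The selected trial has the smallest sampled projected gradient. -/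
  sel_min : ∀ ω r, ‖sampledProjGrad A S b' ρ (sel ω) ω‖ ≤ ‖sampledProjGrad A S b' ρ r ω‖

end Algorithm

end

end ACSPG

/-!
The proof has three ingredients.

*The mean over one trial.* With deterministic weights, `t - 1` times the descent inequality of
iteration `t` is added to one comparison of `x_t` with a fixed minimizer `x*` of `f` on `X`, and the
result is summed over `t` (`prox_step_le`, `sum_sq_projGrad_le`). The function values telescope, no
initial gap `f(x_0) - f*` remains, and the lower curvature of `f` enters only through the bound
`Lhat` that unbiasedness gives for the linearization error of `f` (`Setting.abs_sub_sub_inner_le`).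
What remains random are the squared errors of the gradient estimates, weighted by
`(3 t - 1) / (2 γ_t)`, which is the weight that the batch size rules are made for
(`weight_mul_variance_le`), and two terms of mean zero. They have mean zero because `x*` and the
weights are deterministic and each batch is independent of what precedes it. Hence
`M_k ‖g_X(x_R)‖²`, averaged over the output index, has mean at most `Q_k`
(`lintegral_weightedSum_le`).

*Boosting.* By Markov's inequality a trial has `M_k ‖g_X(x_R)‖² > 2 Q_k` with probability at most
`1 / 2`, and the trials are independent, so all of them fail with probability at most `2 ^ (-R)`
(`measure_forall_lt_le`). The output indices are specified only through their conditional law given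
the samples; `measure_index_le` averages them out.

*Post-optimization.* At a fixed point, the sum of `K` centred light-tailed vectors `ζ_j` satisfies
`P (‖∑ ζ_j‖ ≥ (3 / 2) (1 + lam) σ √K) ≤ exp (-lam² / 3)` (`measure_norm_sum_ge_le`). This is a
dimension-free bound: `cosh ‖β x‖` has a second-order upper estimate in every inner product space
(`exists_cosh_norm_add_le`), so that its mean grows at most by the factor `exp (β² σ²)` with each
summand. As the post-optimization samples are independent of the trials, the bound carries over to
the random candidates (`measure_postErr_ge_le`).

If one trial is good and all estimation errors are at most `c`, then the selected candidate satisfies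
`‖g_X‖ ≤ a + 2 c` with `a² ≤ 2 Q_k / M_k`, and `(a + 2 c)² ≤ 4 a² + (16 / 3) c²` gives the claimed
constants (`norm_exactProjGrad_sq_le`, `le_measureReal_exactProjGrad`).
-/

/-! ### The prox-mapping -/

namespace ACSPG

section ProxMapping

variable {E : Type*} [NormedAddCommGroup E] [InnerProductSpace ℝ E]

lemma proxPoint_spec {X : Set E} (hX : IsCompact X) (hne : X.Nonempty) (x g : E) (γ : ℝ) :
    proxPoint X x g γ ∈ X ∧ IsMinOn (proxObjective x g γ) X (proxPoint X x g γ) := by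
  have hcont : ContinuousOn (proxObjective x g γ) X := by
    unfold proxObjective
    fun_prop
  exact Classical.epsilon_spec (p := fun u => u ∈ X ∧ IsMinOn (proxObjective x g γ) X u)
    (hX.exists_isMinOn hne hcont)

lemma proxPoint_mem {X : Set E} (hX : IsCompact X) (hne : X.Nonempty) (x g : E) (γ : ℝ) :
    proxPoint X x g γ ∈ X :=
  (proxPoint_spec hX hne x g γ).1

/-- The first-order optimality condition of the prox-mapping. -/
lemma proxPoint_variational {X : Set E} (hX : IsCompact X) (hconv : Convex ℝ X)
    (hne : X.Nonempty) (x g : E) (γ : ℝ) {u : E} (hu : u ∈ X) :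
    0 ≤ inner ℝ (g + γ • (proxPoint X x g γ - x)) (u - proxPoint X x g γ) := by
  obtain ⟨hp, hmin⟩ := proxPoint_spec hX hne x g γ
  set p := proxPoint X x g γ with hpdef
  by_contra! hneg
  set a : ℝ := inner ℝ (g + γ • (p - x)) (u - p) with ha
  -- moving from `p` towards `u` by a small step `s` would decrease the objective
  have key : ∀ s : ℝ, 0 ≤ s → s ≤ 1 → 0 ≤ s * a + γ / 2 * s ^ 2 * ‖u - p‖ ^ 2 := by
    intro s hs0 hs1
    have hmem : p + s • (u - p) ∈ X := hconv.add_smul_sub_mem hp hu ⟨hs0, hs1⟩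
    have h := hmin hmem
    simp only [Set.mem_ofPred_eq, proxObjective] at h
    have e1 : ‖x - (p + s • (u - p))‖ ^ 2
        = ‖x - p‖ ^ 2 + 2 * (s * inner ℝ (p - x) (u - p)) + s ^ 2 * ‖u - p‖ ^ 2 := by
      have : x - (p + s • (u - p)) = (x - p) - s • (u - p) := by abel
      rw [this, norm_sub_sq_real, inner_smul_right, norm_smul, mul_pow, Real.norm_eq_abs, sq_abs,
        ← neg_sub p x, inner_neg_left, norm_neg]
      ring
    have e2 : a = inner ℝ g (u - p) + γ * inner ℝ (p - x) (u - p) := by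
      rw [ha, inner_add_left, real_inner_smul_left]
    rw [e1, inner_add_right, inner_smul_right] at h
    rw [e2]
    nlinarith
  have hN : 0 < γ / 2 * ‖u - p‖ ^ 2 := by
    have h1 := key 1 zero_le_one le_rfl
    nlinarith
  set N := γ / 2 * ‖u - p‖ ^ 2 with hNdef
  have h1 := key 1 zero_le_one le_rfl
  have h2 := key (-a / (2 * N)) (div_nonneg (by linarith) (by positivity))
    (by rw [div_le_one (by positivity)]; nlinarith)
  have e3 : (-a / (2 * N)) * a + γ / 2 * (-a / (2 * N)) ^ 2 * ‖u - p‖ ^ 2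
      = - (a ^ 2 / (4 * N)) := by
    have : γ / 2 * (-a / (2 * N)) ^ 2 * ‖u - p‖ ^ 2 = (-a / (2 * N)) ^ 2 * N := by
      rw [hNdef]; ring
    rw [this]; field_simp; ring
  rw [e3] at h2
  have : 0 < a ^ 2 / (4 * N) := by have := hneg.ne; positivity
  linarith

/-- Three-point inequality of the prox-mapping. -/
lemma proxPoint_three_point {X : Set E} (hX : IsCompact X) (hconv : Convex ℝ X)
    (hne : X.Nonempty) (x g : E) (γ : ℝ) {u : E} (hu : u ∈ X) :
    inner ℝ g (proxPoint X x g γ - u) + γ / 2 * ‖proxPoint X x g γ - x‖ ^ 2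
      + γ / 2 * ‖proxPoint X x g γ - u‖ ^ 2 ≤ γ / 2 * ‖x - u‖ ^ 2 := by
  have h := proxPoint_variational hX hconv hne x g γ hu
  set p := proxPoint X x g γ
  have e : ‖x - u‖ ^ 2 = ‖p - x‖ ^ 2 - 2 * inner ℝ (p - x) (p - u) + ‖p - u‖ ^ 2 := by
    rw [← norm_sub_sq_real, ← norm_neg]
    congr 2; abel
  rw [inner_add_left, real_inner_smul_left, ← neg_sub p u, inner_neg_right, inner_neg_right] at h
  rw [e]
  nlinarith

/-- The prox-mapping is the metric projection of `x - γ⁻¹ • g`, hence nonexpansive in this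
point. -/
lemma norm_proxPoint_sub_le {X : Set E} (hX : IsCompact X) (hconv : Convex ℝ X)
    (hne : X.Nonempty) (x g x' g' : E) {γ γ' : ℝ} (hγ : 0 < γ) (hγ' : 0 < γ') :
    ‖proxPoint X x g γ - proxPoint X x' g' γ'‖ ≤ ‖(x - γ⁻¹ • g) - (x' - γ'⁻¹ • g')‖ := by
  have h := proxPoint_variational hX hconv hne x g γ (proxPoint_mem hX hne x' g' γ')
  have h' := proxPoint_variational hX hconv hne x' g' γ' (proxPoint_mem hX hne x g γ)
  set p := proxPoint X x g γ
  set p' := proxPoint X x' g' γ'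
  have a1 : 0 ≤ inner ℝ (p - (x - γ⁻¹ • g)) (p' - p) := by
    have : p - (x - γ⁻¹ • g) = γ⁻¹ • (g + γ • (p - x)) := by
      rw [smul_add, smul_smul, inv_mul_cancel₀ hγ.ne', one_smul]; abel
    rw [this, real_inner_smul_left]; positivity
  have a2 : 0 ≤ inner ℝ (p' - (x' - γ'⁻¹ • g')) (p - p') := by
    have : p' - (x' - γ'⁻¹ • g') = γ'⁻¹ • (g' + γ' • (p' - x')) := by
      rw [smul_add, smul_smul, inv_mul_cancel₀ hγ'.ne', one_smul]; abel
    rw [this, real_inner_smul_left]; positivity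
  set q := x - γ⁻¹ • g
  set q' := x' - γ'⁻¹ • g'
  have h3 : ‖p - p'‖ ^ 2 ≤ inner ℝ (q - q') (p - p') := by
    rw [← real_inner_self_eq_norm_sq]
    rw [← neg_sub p p', inner_neg_right] at a1
    have : inner ℝ (p - p') (p - p')
      = inner ℝ (p - q) (p - p') - inner ℝ (p' - q') (p - p') + inner ℝ (q - q') (p - p') := by
      rw [← inner_sub_left, ← inner_add_left]; congr 1; abel
    linarith
  have h4 := real_inner_le_norm (q - q') (p - p')
  by_contra! hlt
  have : 0 < ‖p - p'‖ := (norm_nonneg _).trans_lt hlt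
  nlinarith

lemma norm_projGrad_sub_le {X : Set E} (hX : IsCompact X) (hconv : Convex ℝ X)
    (hne : X.Nonempty) (x g g' : E) {γ : ℝ} (hγ : 0 < γ) :
    ‖projGrad X x g γ - projGrad X x g' γ‖ ≤ ‖g - g'‖ := by
  have h := norm_proxPoint_sub_le hX hconv hne x g' x g hγ hγ
  have e : (x - γ⁻¹ • g') - (x - γ⁻¹ • g) = γ⁻¹ • (g - g') := by rw [smul_sub]; abel
  rw [e, norm_smul, Real.norm_of_nonneg (by positivity)] at h
  have e2 : projGrad X x g γ - projGrad X x g' γ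
      = γ • (proxPoint X x g' γ - proxPoint X x g γ) := by
    unfold projGrad; rw [← smul_sub]; congr 1; abel
  rw [e2, norm_smul, Real.norm_of_nonneg hγ.le]
  calc γ * _ ≤ γ * (γ⁻¹ * ‖g - g'‖) := by gcongr
    _ = _ := by field_simp

variable [MeasurableSpace E] [BorelSpace E] [SecondCountableTopology E]

lemma measurable_proxPoint {X : Set E} (hX : IsCompact X) (hconv : Convex ℝ X)
    (hne : X.Nonempty) {Ω : Type*} {mΩ : MeasurableSpace Ω} {x g : Ω → E} {γ : Ω → ℝ}
    (hx : Measurable x) (hg : Measurable g) (hγ : Measurable γ) (hpos : ∀ ω, 0 < γ ω) :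
    Measurable fun ω => proxPoint X (x ω) (g ω) (γ ω) := by
  have hproj : Continuous fun q => proxPoint X q (0 : E) 1 := by
    refine (LipschitzWith.of_dist_le_mul (K := 1) fun a b => ?_).continuous
    simpa [dist_eq_norm] using
      norm_proxPoint_sub_le hX hconv hne a 0 b 0 (zero_lt_one' ℝ) (zero_lt_one' ℝ)
  have e : (fun ω => proxPoint X (x ω) (g ω) (γ ω))
      = fun ω => proxPoint X (x ω - (γ ω)⁻¹ • g ω) 0 1 := by
    funext ω
    have := norm_proxPoint_sub_le hX hconv hne (x ω) (g ω) (x ω - (γ ω)⁻¹ • g ω) 0 (hpos ω)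
      (zero_lt_one' ℝ)
    simpa [sub_eq_zero] using this
  rw [e]
  exact hproj.measurable.comp (hx.sub (hγ.inv.smul hg))

end ProxMapping

end ACSPG

/-! ### Concentration of sums of independent light-tailed vectors -/

namespace ACSPG

lemma cosh_sqrt_convex {u v p : ℝ} (hu : 0 ≤ u) (hv : 0 ≤ v) (hp0 : 0 ≤ p) (hp1 : p ≤ 1) :
    Real.cosh √(p * u + (1 - p) * v) ≤ p * Real.cosh √u + (1 - p) * Real.cosh √v := by
  have hw : 0 ≤ p * u + (1 - p) * v := by have := sub_nonneg.2 hp1; positivity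
  have h1 := Real.hasSum_cosh √(p * u + (1 - p) * v)
  have h2 := ((Real.hasSum_cosh √u).mul_left p).add ((Real.hasSum_cosh √v).mul_left (1 - p))
  refine hasSum_le (fun m => ?_) h1 h2
  simp only [pow_mul, Real.sq_sqrt hu, Real.sq_sqrt hv, Real.sq_sqrt hw]
  have := (convexOn_pow (𝕜 := ℝ) m).2 hu hv hp0 (sub_nonneg.2 hp1) (by ring)
  simp only [smul_eq_mul] at this
  rw [← mul_div_assoc, ← mul_div_assoc, ← add_div]
  gcongr

lemma exp_le_add_exp_sq {x : ℝ} (hx : 0 ≤ x) : Real.exp x ≤ x + Real.exp (x ^ 2) := by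
  rcases le_total x 1 with h | h
  · have h1 := (abs_le.1 (Real.abs_exp_sub_one_sub_id_le (abs_le.2 ⟨by linarith, h⟩))).2
    have h2 := Real.add_one_le_exp (x ^ 2)
    linarith
  · have : Real.exp x ≤ Real.exp (x ^ 2) := Real.exp_le_exp.2 (by nlinarith)
    linarith

section Hilbert

variable {E : Type*} [NormedAddCommGroup E] [InnerProductSpace ℝ E]

/-- Second-order upper estimate of `cosh ‖·‖` in an inner product space. Since `u ↦ cosh √u` is
convex, it suffices to compare the two sides for collinear `x` and `h`. -/
lemma exists_cosh_norm_add_le (x : E) : ∃ v : E, ∀ h : E,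
    Real.cosh ‖x + h‖ ≤ Real.cosh ‖x‖ + inner ℝ v h
      + (Real.exp ‖h‖ - 1 - ‖h‖) * Real.cosh ‖x‖ := by
  refine ⟨(Real.sinh ‖x‖ / ‖x‖) • x, fun h => ?_⟩
  have hexp := Real.cosh_add_sinh ‖h‖
  rcases eq_or_ne x 0 with rfl | hx
  · have : ‖h‖ ≤ Real.sinh ‖h‖ := Real.self_le_sinh_iff.2 (norm_nonneg h)
    simp only [zero_add, norm_zero, Real.cosh_zero, smul_zero, inner_zero_left]
    linarith
  rcases eq_or_ne h 0 with rfl | hh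
  · simp
  have ha : 0 < ‖x‖ := norm_pos_iff.2 hx
  have hd : 0 < ‖h‖ := norm_pos_iff.2 hh
  set a := ‖x‖ with hadef
  set d := ‖h‖ with hddef
  set c : ℝ := inner ℝ x h / (a * d) with hc
  have hcin : inner ℝ x h = a * d * c := by rw [hc]; field_simp
  have habs := abs_le.1 (abs_real_inner_div_norm_mul_norm_le_one x h)
  have hc1 : c ≤ 1 := habs.2
  have hc2 : -1 ≤ c := habs.1
  have hnorm : ‖x + h‖ = √((1 + c) / 2 * (a + d) ^ 2 + (1 - (1 + c) / 2) * (a - d) ^ 2) := by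
    rw [← Real.sqrt_sq (norm_nonneg (x + h)), norm_add_sq_real, hcin]
    congr 1; ring
  have hcosh := cosh_sqrt_convex (sq_nonneg (a + d)) (sq_nonneg (a - d))
    (p := (1 + c) / 2) (by linarith) (by linarith)
  rw [← hnorm, Real.sqrt_sq_eq_abs, Real.sqrt_sq_eq_abs, Real.cosh_abs, Real.cosh_abs,
    Real.cosh_add, Real.cosh_sub] at hcosh
  have hin : inner ℝ ((Real.sinh a / a) • x) h = Real.sinh a * d * c := by
    rw [real_inner_smul_left, hcin]; field_simp
  rw [hin]
  have s1 : 0 ≤ Real.sinh d - d := sub_nonneg.2 (Real.self_le_sinh_iff.2 hd.le)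
  have s2 : Real.sinh a ≤ Real.cosh a := (Real.sinh_lt_cosh a).le
  have s3 : 0 ≤ Real.sinh a := Real.sinh_nonneg_iff.2 ha.le
  have s4 : 0 ≤ (Real.cosh a - c * Real.sinh a) * (Real.sinh d - d) := by
    apply mul_nonneg _ s1; nlinarith
  rw [← hexp]
  nlinarith

end Hilbert

section Freezing

variable {Ω : Type*} [MeasurableSpace Ω] {P : Measure Ω} [IsProbabilityMeasure P]

/-- Integration over two independent random elements, one after the other. -/
lemma lintegral_indepFun_eq {α β : Type*} [MeasurableSpace α] [MeasurableSpace β] {U : Ω → α}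
    {Y : Ω → β} (hU : Measurable U) (hY : Measurable Y) (hind : IndepFun U Y P)
    {h : α × β → ENNReal} (hh : Measurable h) :
    ∫⁻ ω, h (U ω, Y ω) ∂P = ∫⁻ ω, ∫⁻ ω', h (U ω, Y ω') ∂P ∂P := by
  have h1 := (indepFun_iff_map_prod_eq_prod_map_map hU.aemeasurable hY.aemeasurable).1 hind
  rw [← lintegral_map (f := h) (g := fun ω => (U ω, Y ω)) hh (hU.prodMk hY), h1,
    lintegral_prod _ hh.aemeasurable, lintegral_map hh.lintegral_prod_right' hU]
  refine lintegral_congr fun ω => ?_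
  exact lintegral_map (hh.comp measurable_prodMk_left) hY

/-- Integration over two independent random elements, one after the other. -/
lemma integral_indepFun_eq {α β : Type*} [MeasurableSpace α] [MeasurableSpace β] {U : Ω → α}
    {Y : Ω → β} (hU : Measurable U) (hY : Measurable Y) (hind : IndepFun U Y P)
    {h : α × β → ℝ} (hh : Measurable h) (hint : Integrable (fun ω => h (U ω, Y ω)) P) :
    ∫ ω, h (U ω, Y ω) ∂P = ∫ ω, ∫ ω', h (U ω, Y ω') ∂P ∂P := by
  have h1 := (indepFun_iff_map_prod_eq_prod_map_map hU.aemeasurable hY.aemeasurable).1 hind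
  have hint' : Integrable h ((P.map U).prod (P.map Y)) := by
    rw [← h1, integrable_map_measure hh.aestronglyMeasurable (hU.prodMk hY).aemeasurable]
    exact hint
  rw [← integral_map (f := h) (φ := fun ω => (U ω, Y ω)) (hU.prodMk hY).aemeasurable
    hh.aestronglyMeasurable, h1, integral_prod _ hint', integral_map hU.aemeasurable
    hh.stronglyMeasurable.integral_prod_right'.aestronglyMeasurable]
  refine integral_congr_ae (Filter.Eventually.of_forall fun ω => ?_)
  exact integral_map hY.aemeasurable (hh.comp measurable_prodMk_left).aestronglyMeasurable

end Freezing

section Sums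

variable {Ω : Type*} [MeasurableSpace Ω] {P : Measure Ω}

/-- The moment bound that a light-tailed norm `Z` satisfies. -/
lemma integral_exp_sub_le [IsProbabilityMeasure P] {Z : Ω → ℝ} (hZm : Measurable Z)
    (hZ : ∀ ω, 0 ≤ Z ω) {σ β : ℝ} (hσ : 0 < σ) (hβ : 0 ≤ β)
    (hint : Integrable (fun ω => Real.exp (Z ω ^ 2 / σ ^ 2)) P)
    (hle : ∫ ω, Real.exp (Z ω ^ 2 / σ ^ 2) ∂P ≤ Real.exp 1) :
    Integrable (fun ω => Real.exp (β * Z ω) - β * Z ω) P ∧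
      ∫ ω, (Real.exp (β * Z ω) - β * Z ω) ∂P ≤ Real.exp (β ^ 2 * σ ^ 2) := by
  have hmeas : Measurable fun ω => Real.exp (β * Z ω) - β * Z ω := by fun_prop
  have hpos : ∀ ω, 0 ≤ Real.exp (β * Z ω) - β * Z ω := fun ω => by
    have := Real.add_one_le_exp (β * Z ω); linarith
  obtain ⟨θ, c, hθ0, hθ1, hc, hdom⟩ : ∃ θ c : ℝ, 0 ≤ θ ∧ θ ≤ 1 ∧ c + θ ≤ β ^ 2 * σ ^ 2 ∧
      ∀ ω, Real.exp (β * Z ω) - β * Z ω ≤ Real.exp (c + θ * (Z ω ^ 2 / σ ^ 2)) := by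
    rcases le_total (β * σ) 1 with h | h
    · refine ⟨β ^ 2 * σ ^ 2, 0, by positivity, ?_, by simp, fun ω => ?_⟩
      · rw [← mul_pow]; exact pow_le_one₀ (by positivity) h
      · have h1 := exp_le_add_exp_sq (x := β * Z ω) (mul_nonneg hβ (hZ ω))
        have h2 : 0 + β ^ 2 * σ ^ 2 * (Z ω ^ 2 / σ ^ 2) = (β * Z ω) ^ 2 := by field_simp; ring
        rw [h2]
        linarith
    · refine ⟨1 / 2, β ^ 2 * σ ^ 2 / 2, by norm_num, by norm_num, ?_, fun ω => ?_⟩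
      · nlinarith
      · have h1 : β * Z ω ≤ β ^ 2 * σ ^ 2 / 2 + 1 / 2 * (Z ω ^ 2 / σ ^ 2) := by
          have h2 : (β * σ) * (Z ω / σ) = β * Z ω := by field_simp
          have h3 := sq_nonneg (β * σ - Z ω / σ)
          rw [← h2, ← div_pow]
          nlinarith
        have := mul_nonneg hβ (hZ ω)
        have := Real.exp_le_exp.2 h1
        linarith
  -- Jensen's inequality for the power `θ ≤ 1`, as an affine majorant touching it at `e`
  have hB : ∀ ω, Real.exp (β * Z ω) - β * Z ω ≤ Real.exp (c + θ)
      * (θ * Real.exp (-1) * Real.exp (Z ω ^ 2 / σ ^ 2) + (1 - θ)) := by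
    intro ω
    set w := Z ω ^ 2 / σ ^ 2
    have h3 := convexOn_exp.2 (Set.mem_univ (w - 1)) (Set.mem_univ 0) hθ0 (sub_nonneg.2 hθ1)
      (by ring)
    simp only [smul_eq_mul, mul_zero, add_zero, Real.exp_zero, mul_one] at h3
    calc _ ≤ Real.exp (c + θ * w) := hdom ω
      _ = Real.exp (c + θ) * Real.exp (θ * (w - 1)) := by rw [← Real.exp_add]; congr 1; ring
      _ ≤ Real.exp (c + θ) * (θ * Real.exp (w - 1) + (1 - θ)) := by gcongr
      _ = _ := by rw [sub_eq_neg_add w 1, Real.exp_add (-1) w]; ring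
  have hi1 : Integrable (fun ω => θ * Real.exp (-1) * Real.exp (Z ω ^ 2 / σ ^ 2)) P :=
    hint.const_mul _
  have hi2 : Integrable (fun ω => Real.exp (c + θ)
      * (θ * Real.exp (-1) * Real.exp (Z ω ^ 2 / σ ^ 2) + (1 - θ))) P :=
    (hi1.add (integrable_const _)).const_mul _
  have hi : Integrable (fun ω => Real.exp (β * Z ω) - β * Z ω) P :=
    hi2.mono' hmeas.aestronglyMeasurable (Filter.Eventually.of_forall fun ω => by
      rw [Real.norm_of_nonneg (hpos ω)]; exact hB ω)
  refine ⟨hi, (integral_mono hi hi2 hB).trans ?_⟩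
  rw [integral_const_mul, integral_add hi1 (integrable_const _), integral_const_mul]
  simp only [integral_const, probReal_univ, one_smul]
  have h5 : θ * Real.exp (-1) * ∫ ω, Real.exp (Z ω ^ 2 / σ ^ 2) ∂P ≤ θ := by
    calc _ ≤ θ * Real.exp (-1) * Real.exp 1 := by gcongr
      _ = θ := by rw [mul_assoc, ← Real.exp_add]; simp
  calc _ ≤ Real.exp (c + θ) * (θ + (1 - θ)) := by gcongr
    _ = Real.exp (c + θ) := by ring
    _ ≤ _ := Real.exp_le_exp.2 hc

variable [IsProbabilityMeasure P]
variable {E : Type*} [NormedAddCommGroup E] [MeasurableSpace E] [BorelSpace E]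
  [SecondCountableTopology E]

/-- If adding any one of the independent vectors `ζ i` to a fixed vector increases the mean of `φ`
at most by applying `T`, then so does adding it to the sum of the others. -/
lemma lintegral_sum_add_le {ι : Type*} {ζ : ι → Ω → E} (hm : ∀ i, Measurable (ζ i))
    (hind : iIndepFun ζ P) {φ : E → ENNReal} (hφ : Measurable φ) {T : ENNReal → ENNReal}
    (hT : ∀ i s, ∫⁻ ω, φ (s + ζ i ω) ∂P ≤ T (φ s)) (s : Finset ι) {i : ι} (hi : i ∉ s) :
    ∫⁻ ω, φ (∑ j ∈ s, ζ j ω + ζ i ω) ∂P ≤ ∫⁻ ω, T (φ (∑ j ∈ s, ζ j ω)) ∂P := by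
  have hS : Measurable fun ω => ∑ j ∈ s, ζ j ω := Finset.measurable_sum _ fun j _ => hm j
  have h0 : IndepFun (fun ω => ∑ j ∈ s, ζ j ω) (ζ i) P := by
    have := hind.indepFun_finsetSum_of_notMem hm hi
    convert this using 1
    ext ω; simp
  rw [lintegral_indepFun_eq hS (hm i) h0 (h := fun p => φ (p.1 + p.2))
    (hφ.comp (measurable_fst.add measurable_snd))]
  exact lintegral_mono fun ω => hT i _

variable [InnerProductSpace ℝ E] [CompleteSpace E]

/-- The variance of a sum of independent centred vectors. -/
lemma lintegral_norm_sum_sq_le {ι : Type*} {ζ : ι → Ω → E} (hm : ∀ i, Measurable (ζ i))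
    (hind : iIndepFun ζ P) (hint : ∀ i, Integrable (ζ i) P) (hmean : ∀ i, ∫ ω, ζ i ω ∂P = 0)
    {V : ℝ} (hsq : ∀ i, Integrable (fun ω => ‖ζ i ω‖ ^ 2) P)
    (hV : ∀ i, ∫ ω, ‖ζ i ω‖ ^ 2 ∂P ≤ V) (s : Finset ι) :
    ∫⁻ ω, ENNReal.ofReal (‖∑ j ∈ s, ζ j ω‖ ^ 2) ∂P ≤ s.card * ENNReal.ofReal V := by
  classical
  induction s using Finset.induction with
  | empty => simp
  | insert i s hi ih =>
    have hstep := lintegral_sum_add_le hm hind (φ := fun x => ENNReal.ofReal (‖x‖ ^ 2))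
      (by fun_prop) (T := fun a => a + ENNReal.ofReal V) (fun i x => by
        have e : ∀ ω, ‖x + ζ i ω‖ ^ 2 = ‖x‖ ^ 2 + 2 * inner ℝ x (ζ i ω) + ‖ζ i ω‖ ^ 2 :=
          fun ω => norm_add_sq_real _ _
        have i1 : Integrable (fun ω => 2 * inner ℝ x (ζ i ω)) P :=
          ((hint i).const_inner x).const_mul 2
        have i2 : Integrable (fun ω => ‖x‖ ^ 2 + 2 * inner ℝ x (ζ i ω)) P :=
          (integrable_const _).add i1
        rw [← ofReal_integral_eq_lintegral_ofReal, ← ENNReal.ofReal_add (by positivity)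
          ((integral_nonneg fun ω => by positivity).trans (hV i))]
        · apply ENNReal.ofReal_le_ofReal
          simp only [e]
          rw [integral_add i2 (hsq i), integral_add (integrable_const _) i1,
            integral_const_mul, integral_inner (hint i), hmean i]
          simpa using hV i
        · simp only [e]; exact i2.add (hsq i)
        · exact Filter.Eventually.of_forall fun ω => by positivity) s hi
    simp only [Finset.sum_insert hi, Finset.card_insert_of_notMem hi]
    simp only [add_comm (ζ i _)]
    refine hstep.trans ?_
    rw [lintegral_add_right _ measurable_const]
    simp only [lintegral_const, measure_univ, mul_one, Nat.cast_add, Nat.cast_one]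
    rw [add_mul, one_mul]
    gcongr

/-- Exponential moments of a sum of independent centred light-tailed vectors. -/
lemma lintegral_cosh_norm_sum_le {ι : Type*} {ζ : ι → Ω → E} (hm : ∀ i, Measurable (ζ i))
    (hind : iIndepFun ζ P) (hint : ∀ i, Integrable (ζ i) P) (hmean : ∀ i, ∫ ω, ζ i ω ∂P = 0)
    {σ β : ℝ} (hσ : 0 < σ) (hβ : 0 ≤ β)
    (hexp : ∀ i, Integrable (fun ω => Real.exp (‖ζ i ω‖ ^ 2 / σ ^ 2)) P)
    (hle : ∀ i, ∫ ω, Real.exp (‖ζ i ω‖ ^ 2 / σ ^ 2) ∂P ≤ Real.exp 1) (s : Finset ι) :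
    ∫⁻ ω, ENNReal.ofReal (Real.cosh ‖β • ∑ j ∈ s, ζ j ω‖) ∂P
      ≤ ENNReal.ofReal (Real.exp (β ^ 2 * σ ^ 2)) ^ s.card := by
  classical
  induction s using Finset.induction with
  | empty => simp
  | insert i s hi ih =>
    have hstep := lintegral_sum_add_le hm hind
      (φ := fun x => ENNReal.ofReal (Real.cosh ‖β • x‖)) (by fun_prop)
      (T := fun a => a * ENNReal.ofReal (Real.exp (β ^ 2 * σ ^ 2))) (fun i x => by
        obtain ⟨v, hv⟩ := exists_cosh_norm_add_le (β • x)
        obtain ⟨hi1, hi2⟩ := integral_exp_sub_le (hm i).norm (fun ω => norm_nonneg _) hσ hβ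
          (hexp i) (hle i)
        have i1 : Integrable (fun ω => β * inner ℝ v (ζ i ω)) P :=
          ((hint i).const_inner v).const_mul β
        have i3 : Integrable (fun ω => (Real.exp (β * ‖ζ i ω‖) - β * ‖ζ i ω‖)
          * Real.cosh ‖β • x‖) P := hi1.mul_const _
        have hle' : ∀ ω, Real.cosh ‖β • (x + ζ i ω)‖ ≤ β * inner ℝ v (ζ i ω)
            + (Real.exp (β * ‖ζ i ω‖) - β * ‖ζ i ω‖) * Real.cosh ‖β • x‖ := fun ω => by
          have := hv (β • ζ i ω)
          rw [← smul_add, inner_smul_right, norm_smul β (ζ i ω), Real.norm_of_nonneg hβ] at this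
          linarith
        calc ∫⁻ ω, ENNReal.ofReal (Real.cosh ‖β • (x + ζ i ω)‖) ∂P
            ≤ ∫⁻ ω, ENNReal.ofReal (β * inner ℝ v (ζ i ω)
              + (Real.exp (β * ‖ζ i ω‖) - β * ‖ζ i ω‖) * Real.cosh ‖β • x‖) ∂P :=
              lintegral_mono fun ω => ENNReal.ofReal_le_ofReal (hle' ω)
          _ = ENNReal.ofReal (∫ ω, (β * inner ℝ v (ζ i ω)
              + (Real.exp (β * ‖ζ i ω‖) - β * ‖ζ i ω‖) * Real.cosh ‖β • x‖) ∂P) :=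
              (ofReal_integral_eq_lintegral_ofReal (i1.add i3) (Filter.Eventually.of_forall
                fun ω => (Real.cosh_pos _).le.trans (hle' ω))).symm
          _ ≤ ENNReal.ofReal (Real.cosh ‖β • x‖ * Real.exp (β ^ 2 * σ ^ 2)) := by
              apply ENNReal.ofReal_le_ofReal
              rw [integral_add i1 i3, integral_const_mul, integral_inner (hint i), hmean i,
                integral_mul_const, inner_zero_right, mul_zero, zero_add, mul_comm]
              have := (Real.cosh_pos ‖β • x‖).le
              gcongr
          _ = _ := ENNReal.ofReal_mul (Real.cosh_pos _).le) s hi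
    simp only [Finset.sum_insert hi, Finset.card_insert_of_notMem hi]
    simp only [add_comm (ζ i _)]
    refine hstep.trans ?_
    rw [lintegral_mul_const _ (by fun_prop), pow_succ]
    exact mul_le_mul_left ih _

/-- Large deviations of a sum of independent centred light-tailed vectors. -/
lemma measure_norm_sum_ge_le {ι : Type*} {ζ : ι → Ω → E} (hm : ∀ i, Measurable (ζ i))
    (hind : iIndepFun ζ P) (hint : ∀ i, Integrable (ζ i) P) (hmean : ∀ i, ∫ ω, ζ i ω ∂P = 0)
    {σ : ℝ} (hσ : 0 < σ)
    (hsq : ∀ i, Integrable (fun ω => ‖ζ i ω‖ ^ 2) P)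
    (hV : ∀ i, ∫ ω, ‖ζ i ω‖ ^ 2 ∂P ≤ σ ^ 2)
    (hexp : ∀ i, Integrable (fun ω => Real.exp (‖ζ i ω‖ ^ 2 / σ ^ 2)) P)
    (hle : ∀ i, ∫ ω, Real.exp (‖ζ i ω‖ ^ 2 / σ ^ 2) ∂P ≤ Real.exp 1) (s : Finset ι)
    (hs : s.Nonempty) {lam : ℝ} (hlam : 0 ≤ lam) :
    P {ω | 3 / 2 * (1 + lam) * σ * √(s.card : ℝ) ≤ ‖∑ j ∈ s, ζ j ω‖}
      ≤ ENNReal.ofReal (Real.exp (-(lam ^ 2 / 3))) := by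
  have hK : (0 : ℝ) < s.card := by exact_mod_cast hs.card_pos
  set K : ℝ := (s.card : ℝ) with hKdef
  set r := 3 / 2 * (1 + lam) * σ * √K with hr
  have hrpos : 0 < r := by positivity
  have hr2 : r ^ 2 = 9 / 4 * (1 + lam) ^ 2 * σ ^ 2 * K := by
    rw [hr, mul_pow, Real.sq_sqrt hK.le]; ring
  rcases le_total lam 1 with h | h
  · -- for small `lam` the right-hand side is at least `2 / 3`: Chebyshev's inequality
    have h1 := lintegral_norm_sum_sq_le hm hind hint hmean hsq hV s
    have h2 := meas_ge_le_lintegral_div (μ := P)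
      (f := fun ω => ENNReal.ofReal (‖∑ j ∈ s, ζ j ω‖ ^ 2)) (by fun_prop)
      (ε := ENNReal.ofReal (r ^ 2)) (by simpa using hrpos.ne') ENNReal.ofReal_ne_top
    refine (measure_mono fun ω hω => ?_).trans (h2.trans ?_)
    · exact ENNReal.ofReal_le_ofReal (pow_le_pow_left₀ hrpos.le hω 2)
    · refine (ENNReal.div_le_div_right h1 _).trans ?_
      rw [← ENNReal.ofReal_natCast, ← ENNReal.ofReal_mul (by positivity),
        ← ENNReal.ofReal_div_of_pos (by positivity)]
      apply ENNReal.ofReal_le_ofReal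
      have h4 := Real.add_one_le_exp (-(lam ^ 2 / 3))
      refine le_trans ?_ h4
      rw [div_le_iff₀ (by positivity), hr2]
      have h5 : 1 ≤ (-(lam ^ 2 / 3) + 1) * (9 / 4 * (1 + lam) ^ 2) := by
        have a1 : 2 / 3 ≤ -(lam ^ 2 / 3) + 1 := by nlinarith
        have a2 : 9 / 4 ≤ 9 / 4 * (1 + lam) ^ 2 := by nlinarith
        nlinarith
      have : 0 ≤ K * σ ^ 2 := by positivity
      nlinarith
  · -- for large `lam` an exponential moment with the optimal parameter
    set β := 3 / 4 * (1 + lam) / (σ * √K) with hβ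
    have hβ0 : 0 ≤ β := by positivity
    have h1 := lintegral_cosh_norm_sum_le hm hind hint hmean hσ hβ0 hexp hle s
    have h2 := meas_ge_le_lintegral_div (μ := P)
      (f := fun ω => ENNReal.ofReal (Real.cosh ‖β • ∑ j ∈ s, ζ j ω‖)) (by fun_prop)
      (ε := ENNReal.ofReal (Real.exp (β * r) / 2)) (by simp [Real.exp_pos]) ENNReal.ofReal_ne_top
    refine (measure_mono fun ω hω => ?_).trans (h2.trans ?_)
    · apply ENNReal.ofReal_le_ofReal
      rw [norm_smul, Real.norm_of_nonneg hβ0]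
      have : Real.exp (β * r) ≤ Real.exp (β * ‖∑ j ∈ s, ζ j ω‖) :=
        Real.exp_le_exp.2 (mul_le_mul_of_nonneg_left hω hβ0)
      rw [Real.cosh_eq]
      have := Real.exp_pos (-(β * ‖∑ j ∈ s, ζ j ω‖))
      linarith
    · refine (ENNReal.div_le_div_right h1 _).trans ?_
      rw [← ENNReal.ofReal_pow (by positivity), ← ENNReal.ofReal_div_of_pos (by positivity)]
      apply ENNReal.ofReal_le_ofReal
      rw [div_le_iff₀ (by positivity), ← Real.exp_nat_mul, ← hKdef]
      have hsK : √K ≠ 0 := by positivity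
      have e1 : β * r = 9 / 8 * (1 + lam) ^ 2 := by
        rw [hβ, hr]; field_simp; ring
      have e2 : K * (β ^ 2 * σ ^ 2) = 9 / 16 * (1 + lam) ^ 2 := by
        rw [hβ, div_pow, mul_pow, mul_pow, Real.sq_sqrt hK.le]; field_simp; ring
      rw [e1, e2]
      have h6 : (2 : ℝ) ≤ Real.exp 1 := by have := Real.add_one_le_exp (1 : ℝ); linarith
      have h7 : Real.exp (9 / 16 * (1 + lam) ^ 2) * Real.exp 1
          ≤ Real.exp (-(lam ^ 2 / 3)) * Real.exp (9 / 8 * (1 + lam) ^ 2) := by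
        rw [← Real.exp_add, ← Real.exp_add]
        exact Real.exp_le_exp.2 (by nlinarith)
      have h8 := Real.exp_pos (9 / 16 * (1 + lam) ^ 2)
      nlinarith

end Sums

end ACSPG

/-! ### The descent inequality along a trajectory -/

namespace ACSPG

section Descent

variable {E : Type*} [NormedAddCommGroup E] [InnerProductSpace ℝ E]

/-- A function with `Λ`-Lipschitz gradient on a convex set has lower curvature `Λ`. -/
lemma neg_le_sub_sub_inner [CompleteSpace E] {X : Set E} (hconv : Convex ℝ X) {f : E → ℝ}
    {gradf : E → E} {Λ : ℝ}
    (hgrad : ∀ x ∈ X, HasGradientWithinAt f (gradf x) X x)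
    (hlip : ∀ x ∈ X, ∀ y ∈ X, ‖gradf x - gradf y‖ ≤ Λ * ‖x - y‖) {x y : E} (hx : x ∈ X)
    (hy : y ∈ X) : -(Λ / 2) * ‖x - y‖ ^ 2 ≤ f x - f y - inner ℝ (gradf y) (x - y) := by
  set v := x - y with hv
  have hseg : ∀ s ∈ Set.Icc (0 : ℝ) 1, y + s • v ∈ X := fun s hs =>
    hconv.add_smul_sub_mem hy hx hs
  set φ : ℝ → ℝ := fun s =>
    f (y + s • v) - s * inner ℝ (gradf y) v + Λ / 2 * (s ^ 2 * ‖v‖ ^ 2) with hφ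
  have hderiv : ∀ s ∈ Set.Icc (0 : ℝ) 1, HasDerivWithinAt φ
      (inner ℝ (gradf (y + s • v)) v - inner ℝ (gradf y) v + Λ * s * ‖v‖ ^ 2) (Set.Icc 0 1) s := by
    intro s hs
    have h1 : HasDerivWithinAt (fun s : ℝ => y + s • v) v (Set.Icc 0 1) s := by
      simpa using ((hasDerivWithinAt_id s (Set.Icc (0 : ℝ) 1)).smul_const v).const_add y
    have h2 := (hgrad _ (hseg s hs)).hasFDerivWithinAt.comp_hasDerivWithinAt s h1 hseg
    have h3 : HasDerivWithinAt (fun s : ℝ => s * inner ℝ (gradf y) v) (inner ℝ (gradf y) v)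
        (Set.Icc 0 1) s := by
      simpa using (hasDerivWithinAt_id s (Set.Icc (0 : ℝ) 1)).mul_const (inner ℝ (gradf y) v)
    have h4 : HasDerivWithinAt (fun s : ℝ => Λ / 2 * (s ^ 2 * ‖v‖ ^ 2)) (Λ * s * ‖v‖ ^ 2)
        (Set.Icc 0 1) s := by
      have := (((hasDerivWithinAt_id s (Set.Icc (0 : ℝ) 1)).pow 2).mul_const
        (‖v‖ ^ 2)).const_mul (Λ / 2)
      refine this.congr_deriv ?_
      simp only [id_eq]
      push_cast
      ring
    have h5 := (h2.sub h3).add h4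
    exact h5.congr_deriv (by simp)
  have hmono : MonotoneOn φ (Set.Icc 0 1) := by
    refine monotoneOn_of_deriv_nonneg (convex_Icc 0 1)
      (fun s hs => (hderiv s hs).continuousWithinAt) ?_ ?_
    · intro s hs
      have hs' := interior_subset hs
      exact ((hderiv s hs').hasDerivAt
        (mem_interior_iff_mem_nhds.1 hs)).differentiableAt.differentiableWithinAt
    · intro s hs
      have hs' := interior_subset hs
      rw [((hderiv s hs').hasDerivAt (mem_interior_iff_mem_nhds.1 hs)).deriv, ← inner_sub_left]
      have h1 := hlip _ (hseg s hs') y hy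
      rw [add_sub_cancel_left, norm_smul, Real.norm_of_nonneg hs'.1] at h1
      have h2 := (abs_le.1 (abs_real_inner_le_norm (gradf (y + s • v) - gradf y) v)).1
      have h3 := mul_le_mul_of_nonneg_right h1 (norm_nonneg v)
      nlinarith
  have h := hmono (Set.left_mem_Icc.2 zero_le_one) (Set.right_mem_Icc.2 zero_le_one) zero_le_one
  have e : y + v = x := by rw [hv]; abel
  simp only [hφ, zero_smul, add_zero, one_smul, e] at h
  linarith

/-- One iteration: `τ` times the descent inequality at the current point plus once the comparison
with a reference point `u`. Here `H` is an estimate of the linearization error of `f` between the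
two iterates, bounded by the next stepsize parameter `γ'`, and `g` is an estimate of the
gradient. -/
lemma prox_step_le {X : Set E} (hX : IsCompact X) (hconv : Convex ℝ X) {f : E → ℝ}
    {gradf : E → E} {Λ : ℝ} {x x' u g : E} {γ γ' τ H : ℝ} (hx : x ∈ X) (hu : u ∈ X)
    (hγ : 0 < γ) (hτ : 0 ≤ τ) (hx' : x' = proxPoint X x g γ)
    (hlow : -(Λ / 2) * ‖u - x‖ ^ 2 ≤ f u - f x - inner ℝ (gradf x) (u - x))
    (hH : H ≤ γ' / 4 * ‖x' - x‖ ^ 2) :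
    τ / (4 * γ) * ‖projGrad X x (gradf x) γ‖ ^ 2 + (τ + 1) * (f x' - f u)
        + γ / 2 * ‖x' - u‖ ^ 2
      ≤ τ * (f x - f u) + γ / 2 * ‖x - u‖ ^ 2 + (τ + 1) / 4 * (γ' - γ) * ‖x' - x‖ ^ 2
        + Λ / 2 * ‖x - u‖ ^ 2
        + ((3 * τ + 2) / (2 * γ) * ‖g - gradf x‖ ^ 2
          + (τ + 1) * (f x' - f x - inner ℝ (gradf x) (x' - x) - H)
          - inner ℝ (g - gradf x) (x - u)) := by
  have hne : X.Nonempty := ⟨x, hx⟩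
  have t1 := proxPoint_three_point hX hconv hne x g γ hu
  have t2 := proxPoint_three_point hX hconv hne x g γ hx
  have s1 := norm_projGrad_sub_le hX hconv hne x (gradf x) g hγ
  have s2 : ‖projGrad X x g γ‖ = γ * ‖x' - x‖ := by
    rw [projGrad, ← hx', norm_smul, Real.norm_of_nonneg hγ.le, norm_sub_rev]
  rw [← hx'] at t1 t2
  rw [sub_self, norm_zero] at t2
  set pg := projGrad X x (gradf x) γ
  rw [norm_sub_rev (gradf x) g] at s1
  set δ := g - gradf x with hδ
  have eg : g = gradf x + δ := by rw [hδ]; abel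
  have s3 : ‖pg‖ ^ 2 ≤ 2 * γ ^ 2 * ‖x' - x‖ ^ 2 + 2 * ‖δ‖ ^ 2 := by
    have h1 : ‖pg‖ ≤ γ * ‖x' - x‖ + ‖δ‖ := by
      rw [← s2]
      calc ‖pg‖ = ‖projGrad X x g γ + (pg - projGrad X x g γ)‖ := by congr 1; abel
        _ ≤ _ := (norm_add_le _ _).trans (by gcongr)
    have h2 := pow_le_pow_left₀ (norm_nonneg _) h1 2
    nlinarith [sq_nonneg (γ * ‖x' - x‖ - ‖δ‖)]
  have s4 : τ / (4 * γ) * ‖pg‖ ^ 2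
      ≤ τ * γ / 2 * ‖x' - x‖ ^ 2 + τ / (2 * γ) * ‖δ‖ ^ 2 := by
    calc _ ≤ τ / (4 * γ) * (2 * γ ^ 2 * ‖x' - x‖ ^ 2 + 2 * ‖δ‖ ^ 2) := by gcongr
      _ = _ := by field_simp; ring
  have s5 : -inner ℝ δ (x' - x) ≤ γ / 4 * ‖x' - x‖ ^ 2 + 1 / γ * ‖δ‖ ^ 2 := by
    have h1 := (abs_le.1 (abs_real_inner_le_norm δ (x' - x))).1
    have h2 : 0 ≤ (γ / 2 * ‖x' - x‖ - ‖δ‖) ^ 2 / γ := by positivity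
    have h3 : (γ / 2 * ‖x' - x‖ - ‖δ‖) ^ 2 / γ
        = γ / 4 * ‖x' - x‖ ^ 2 + 1 / γ * ‖δ‖ ^ 2 - ‖δ‖ * ‖x' - x‖ := by field_simp; ring
    linarith
  have e1 : inner ℝ (gradf x) (x' - u)
      = inner ℝ (gradf x) (x' - x) - inner ℝ (gradf x) (u - x) := by
    rw [← inner_sub_right]; congr 1; abel
  have e2 : inner ℝ δ (x' - u) = inner ℝ δ (x' - x) + inner ℝ δ (x - u) := by
    rw [← inner_add_right]; congr 1; abel
  rw [eg, inner_add_left] at t1 t2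
  rw [e1, e2] at t1
  rw [norm_sub_rev u x] at hlow
  have e3 : (3 * τ + 2) / (2 * γ) * ‖δ‖ ^ 2
      = τ / (2 * γ) * ‖δ‖ ^ 2 + (τ + 1) * (1 / γ * ‖δ‖ ^ 2) := by field_simp; ring
  rw [e3]
  have m1 := mul_le_mul_of_nonneg_left t2 hτ
  have m2 := mul_le_mul_of_nonneg_left s5 (by linarith : 0 ≤ τ + 1)
  have m3 := mul_le_mul_of_nonneg_left hH (by linarith : 0 ≤ τ + 1)
  linarith

/-- Summation of the one-step inequalities over a trajectory with nondecreasing stepsize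
parameters `Γ t`. -/
lemma sum_sq_projGrad_le {X : Set E} (hX : IsCompact X) (hconv : Convex ℝ X) {f : E → ℝ}
    {gradf : E → E} {Λ D : ℝ} {u : E} {x g : ℕ → E} {Γ H : ℕ → ℝ} (hx : ∀ t, x t ∈ X)
    (hu : u ∈ X) (hmin : ∀ y ∈ X, f u ≤ f y) (hD : ∀ y ∈ X, ∀ z ∈ X, ‖y - z‖ ≤ D)
    (hΓ : ∀ t, 0 < Γ t) (hmono : ∀ t, Γ t ≤ Γ (t + 1)) (hΛ : 0 ≤ Λ)
    (hprox : ∀ t, x (t + 1) = proxPoint X (x t) (g t) (Γ t))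
    (hlow : ∀ t, -(Λ / 2) * ‖u - x t‖ ^ 2 ≤ f u - f (x t) - inner ℝ (gradf (x t)) (u - x t))
    (hH : ∀ t, H t ≤ Γ (t + 1) / 4 * ‖x (t + 1) - x t‖ ^ 2) (k : ℕ) (hk : Γ k ≤ 2 * Λ) :
    ∑ t ∈ Finset.range k, (t : ℝ) / (4 * Γ t) * ‖projGrad X (x t) (gradf (x t)) (Γ t)‖ ^ 2
      ≤ ((k : ℝ) + 1) * Λ * D ^ 2
        + ∑ t ∈ Finset.range k, ((3 * (t : ℝ) + 2) / (2 * Γ t) * ‖g t - gradf (x t)‖ ^ 2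
          + ((t : ℝ) + 1) * (f (x (t + 1)) - f (x t)
            - inner ℝ (gradf (x t)) (x (t + 1) - x t) - H t)
          - inner ℝ (g t - gradf (x t)) (x t - u)) := by
  set N : ℕ → ℝ := fun t => (3 * (t : ℝ) + 2) / (2 * Γ t) * ‖g t - gradf (x t)‖ ^ 2
          + ((t : ℝ) + 1) * (f (x (t + 1)) - f (x t)
            - inner ℝ (gradf (x t)) (x (t + 1) - x t) - H t)
          - inner ℝ (g t - gradf (x t)) (x t - u) with hN
  have hsq : ∀ y ∈ X, ∀ z ∈ X, ‖y - z‖ ^ 2 ≤ D ^ 2 := fun y hy z hz =>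
    pow_le_pow_left₀ (norm_nonneg _) (hD y hy z hz) 2
  have key : ∀ m : ℕ,
      ∑ t ∈ Finset.range m, (t : ℝ) / (4 * Γ t) * ‖projGrad X (x t) (gradf (x t)) (Γ t)‖ ^ 2
        + m * (f (x m) - f u) + Γ m / 2 * ‖x m - u‖ ^ 2
      ≤ Γ m / 2 * D ^ 2 + m / 4 * Γ m * D ^ 2 + m * (Λ / 2 * D ^ 2)
        + ∑ t ∈ Finset.range m, N t := by
    intro m
    induction m with
    | zero =>
      have := mul_le_mul_of_nonneg_left (hsq _ (hx 0) _ hu) (by have := hΓ 0; positivity :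
        0 ≤ Γ 0 / 2)
      simpa using this
    | succ m ih =>
      have hstep := prox_step_le hX hconv (τ := m) (hx m) hu (hΓ m) (Nat.cast_nonneg m)
        (hprox m) (hlow m) (hH m)
      rw [Finset.sum_range_succ, Finset.sum_range_succ]
      have b1 := mul_le_mul_of_nonneg_left (hsq _ (hx m) _ hu) (by positivity : 0 ≤ Λ / 2)
      have b2 := mul_le_mul_of_nonneg_left (hsq _ (hx (m + 1)) _ (hx m))
        (by have := sub_nonneg.2 (hmono m); positivity :
          0 ≤ ((m : ℝ) + 1) / 4 * (Γ (m + 1) - Γ m))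
      have b3 := mul_le_mul_of_nonneg_left (hsq _ (hx (m + 1)) _ hu)
        (by have := sub_nonneg.2 (hmono m); positivity : 0 ≤ (Γ (m + 1) - Γ m) / 2)
      have b4 : 0 ≤ Γ m / 4 * D ^ 2 := by have := hΓ m; positivity
      push_cast
      simp only [hN] at ih ⊢
      linarith
  have h := key k
  have h1 : 0 ≤ (k : ℝ) * (f (x k) - f u) :=
    mul_nonneg (Nat.cast_nonneg k) (sub_nonneg.2 (hmin _ (hx k)))
  have h2 : 0 ≤ Γ k / 2 * ‖x k - u‖ ^ 2 := by have := hΓ k; positivity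
  have h3 : Γ k * ((1 / 2 + k / 4) * D ^ 2) ≤ 2 * Λ * ((1 / 2 + k / 4) * D ^ 2) := by gcongr
  linarith

end Descent

end ACSPG

/-! ### Measurability of the run -/

namespace ACSPG

section Carath

variable {E Ξ Ω V : Type*} {mΩ : MeasurableSpace Ω}

lemma measurable_comp_continuousOn [TopologicalSpace E] [MeasurableSpace E] [BorelSpace E]
    [TopologicalSpace V] [TopologicalSpace.PseudoMetrizableSpace V] [MeasurableSpace V]
    [BorelSpace V] {X : Set E} {g : E → V} (hg : ContinuousOn g X) {x : Ω → E} (hx : Measurable x)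
    (hxX : ∀ ω, x ω ∈ X) : Measurable fun ω => g (x ω) :=
  (continuousOn_iff_continuous_domRestrict.1 hg).measurable.comp (hx.subtype_mk (h := hxX))

lemma measurable_batchMean [NormedAddCommGroup V] [NormedSpace ℝ V] [MeasurableSpace V]
    [BorelSpace V] [SecondCountableTopology V] {h : Ω → Ξ → V} {s : Ω → ℕ → Ξ}
    (hh : ∀ j, Measurable fun ω => h ω (s ω j)) {b : Ω → ℕ} (hb : Measurable b) :
    Measurable fun ω => batchMean (b ω) (h ω) (s ω) := by
  have h1 : Measurable fun p : ℕ × Ω => batchMean p.1 (h p.2) (s p.2) := by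
    refine measurable_from_prod_countable_right fun m => ?_
    exact (Finset.measurable_fun_sum (Finset.range m) fun j _ => hh j).const_smul ((m : ℝ)⁻¹)
  exact h1.comp (hb.prodMk measurable_id)

variable [MeasurableSpace Ξ] [MetricSpace E] [SecondCountableTopology E] [MeasurableSpace E]
  [BorelSpace E]

/-- Evaluation of a Carathéodory function at a random point of `X` and a random sample. -/
lemma measurable_comp_of_continuousOn [TopologicalSpace V]
    [TopologicalSpace.PseudoMetrizableSpace V]
    [MeasurableSpace V] [BorelSpace V] {X : Set E} {h : E → Ξ → V}
    (hm : ∀ x ∈ X, Measurable (h x)) (hc : ∀ ξ, ContinuousOn (fun x => h x ξ) X)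
    {x : Ω → E} (hx : Measurable x) (hxX : ∀ ω, x ω ∈ X) {y : Ω → Ξ} (hy : Measurable y) :
    Measurable fun ω => h (x ω) (y ω) := by
  have h1 : Measurable (Function.uncurry fun (p : X) (ξ : Ξ) => h p ξ) :=
    measurable_uncurry_of_continuous_of_measurable
      (fun ξ => continuousOn_iff_continuous_domRestrict.1 (hc ξ)) (fun p => hm p p.2)
  exact h1.comp ((hx.subtype_mk (h := hxX)).prodMk hy)

end Carath

lemma BatchRule.measurable_size (rule : BatchRule) (t : ℕ) : Measurable (rule.size t) := by
  cases rule with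
  | adaptive α =>
    exact measurable_const.max (Nat.measurable_ceil.comp (by fun_prop))
  | constant b => exact measurable_const

lemma BatchRule.one_le_size {rule : BatchRule} (h : rule.Valid) (t : ℕ) (γ : ℝ) :
    1 ≤ rule.size t γ := by
  cases rule with
  | adaptive α => exact le_max_left _ _
  | constant b => exact h

variable {E Ξ : Type*} [NormedAddCommGroup E] [InnerProductSpace ℝ E]

/-- The linearization error `F(y, ξ) - F(x, ξ) - ⟨G(x, ξ), y - x⟩` of the stochastic function. -/
noncomputable def linErr (A : Input E Ξ) (x y : E) (ξ : Ξ) : ℝ :=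
  A.F y ξ - A.F x ξ - inner ℝ (A.G x ξ) (y - x)

lemma localSmoothness_eq (A : Input E Ξ) (b : ℕ) (s : ℕ → Ξ) (x y : E) :
    localSmoothness A.F A.G b s x y = 2 * batchMean b (linErr A x y) s / ‖y - x‖ ^ 2 := by
  unfold localSmoothness batchMean linErr
  rw [Finset.sum_sub_distrib, Finset.sum_sub_distrib, ← sum_inner, inner_smul_left]
  simp only [smul_eq_mul, conj_trivial]
  ring

/-- The standing assumptions on the feasible set, the oracle and the input of the method that the
analysis of a single trial uses. -/
structure Setting [MeasurableSpace E] [CompleteSpace E] [MeasurableSpace Ξ] (μ : Measure Ξ)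
    (A : Input E Ξ) (f : E → ℝ) (gradf : E → E) (σ Lhat Lbar : ℝ) : Prop where
  compact : IsCompact A.X
  convex : Convex ℝ A.X
  hasGradient : ∀ x ∈ A.X, HasGradientWithinAt f (gradf x) A.X x
  gradf_continuousOn : ContinuousOn gradf A.X
  unbiased : IsUnbiased μ A.X A.G gradf
  variance : HasBoundedVariance μ A.X A.G gradf σ
  smooth : IsSmoothStochastic μ A.X f A.F A.G Lhat Lbar
  x₀_mem : A.x₀ ∈ A.X
  L₀_pos : 0 < A.L₀
  L₀_le : A.L₀ ≤ Lhat
  valid : A.rule.Valid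

namespace Setting

variable [MeasurableSpace E] [CompleteSpace E] [MeasurableSpace Ξ] {μ : Measure Ξ}
  {A : Input E Ξ} {f : E → ℝ} {gradf : E → E} {σ Lhat Lbar : ℝ}

section Deterministic

variable (h : Setting μ A f gradf σ Lhat Lbar)
include h

lemma nonempty : A.X.Nonempty := ⟨_, h.x₀_mem⟩

lemma Lhat_pos : 0 < Lhat := h.L₀_pos.trans_le h.L₀_le

lemma continuousOn_G (ξ : Ξ) : ContinuousOn (fun x => A.G x ξ) A.X := by
  obtain ⟨ell, -, h0, hl, -⟩ := h.smooth.smooth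
  refine (LipschitzOnWith.of_dist_le_mul (K := ⟨ell ξ, h0 ξ⟩) fun x hx y hy => ?_).continuousOn
  rw [dist_eq_norm, dist_eq_norm]
  exact hl ξ x hx y hy

lemma continuousOn_F (ξ : Ξ) : ContinuousOn (fun x => A.F x ξ) A.X := fun x hx =>
  (h.smooth.hasGradient ξ x hx).hasFDerivWithinAt.continuousWithinAt

lemma continuousOn_f : ContinuousOn f A.X := fun x hx =>
  (h.hasGradient x hx).hasFDerivWithinAt.continuousWithinAt

lemma exists_min : ∃ u ∈ A.X, ∀ y ∈ A.X, f u ≤ f y :=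
  h.compact.exists_isMinOn h.nonempty h.continuousOn_f

/-- Almost surely, the linearization error is at most `Lhat / 2 ‖y - x‖²` in absolute value. -/
lemma ae_abs_linErr_le : ∀ᵐ ξ ∂μ, ∀ x ∈ A.X, ∀ y ∈ A.X,
    |linErr A x y ξ| ≤ Lhat / 2 * ‖y - x‖ ^ 2 := by
  obtain ⟨ell, -, h0, hl, hs, hae, -⟩ := h.smooth.smooth
  filter_upwards [hae] with ξ hξ x hx y hy
  have h1 := hs ξ y hy x hx
  have h2 := neg_le_sub_sub_inner h.convex (h.smooth.hasGradient ξ) (hl ξ) hy hx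
  have h3 : ell ξ / 2 * ‖y - x‖ ^ 2 ≤ Lhat / 2 * ‖y - x‖ ^ 2 := by gcongr
  unfold linErr
  rw [abs_le]
  constructor <;> linarith

lemma integrable_linErr {x y : E} (hx : x ∈ A.X) (hy : y ∈ A.X) : Integrable (linErr A x y) μ :=
  ((h.smooth.integrable y hy).sub (h.smooth.integrable x hx)).sub
    ((h.unbiased.integrable x hx).inner_const _)

lemma integral_linErr {x y : E} (hx : x ∈ A.X) (hy : y ∈ A.X) :
    ∫ ξ, linErr A x y ξ ∂μ = f y - f x - inner ℝ (gradf x) (y - x) := by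
  have hi : Integrable (fun ξ => A.F y ξ - A.F x ξ) μ :=
    (h.smooth.integrable y hy).sub (h.smooth.integrable x hx)
  unfold linErr
  rw [integral_sub hi ((h.unbiased.integrable x hx).inner_const _),
    integral_sub (h.smooth.integrable y hy) (h.smooth.integrable x hx), h.smooth.mean y hy,
    h.smooth.mean x hx]
  congr 1
  rw [← h.unbiased.mean x hx, real_inner_comm, ← integral_inner (h.unbiased.integrable x hx)]
  exact integral_congr_ae (Filter.Eventually.of_forall fun ξ => real_inner_comm _ _)

/-- The linearization error of `f` is at most `Lhat / 2 ‖y - x‖²` in absolute value. -/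
lemma abs_sub_sub_inner_le [IsProbabilityMeasure μ] {x y : E} (hx : x ∈ A.X) (hy : y ∈ A.X) :
    |f y - f x - inner ℝ (gradf x) (y - x)| ≤ Lhat / 2 * ‖y - x‖ ^ 2 := by
  rw [← h.integral_linErr hx hy]
  have := norm_integral_le_of_norm_le_const (μ := μ) (f := linErr A x y)
    (C := Lhat / 2 * ‖y - x‖ ^ 2)
    (by filter_upwards [h.ae_abs_linErr_le] with ξ hξ using hξ x hx y hy)
  simpa using this

lemma state_mem (s s' : ℕ → ℕ → Ξ) (b' : ℕ → ℕ) (t : ℕ) : (state A s s' b' t).1 ∈ A.X := by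
  cases t with
  | zero => exact h.x₀_mem
  | succ t => exact proxPoint_mem h.compact h.nonempty _ _ _

end Deterministic

end Setting

lemma state_snd_mono (A : Input E Ξ) (s s' : ℕ → ℕ → Ξ) (b' : ℕ → ℕ) (t : ℕ) :
    (state A s s' b' t).2 ≤ (state A s s' b' (t + 1)).2 := le_max_left _ _

lemma L₀_le_state_snd (A : Input E Ξ) (s s' : ℕ → ℕ → Ξ) (b' : ℕ → ℕ) (t : ℕ) :
    A.L₀ ≤ (state A s s' b' t).2 := by
  induction t with
  | zero => exact le_rfl
  | succ t ih => exact ih.trans (state_snd_mono A s s' b' t)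

/-- The linearization error of a second batch is controlled by the next stepsize parameter. -/
lemma batchMean_linErr_le (A : Input E Ξ) (s s' : ℕ → ℕ → Ξ) (b' : ℕ → ℕ) (t : ℕ) :
    batchMean (b' (t + 1)) (linErr A (state A s s' b' t).1 (state A s s' b' (t + 1)).1)
        (s' (t + 1))
      ≤ 2 * (state A s s' b' (t + 1)).2 / 4
        * ‖(state A s s' b' (t + 1)).1 - (state A s s' b' t).1‖ ^ 2 := by
  set x := (state A s s' b' t).1
  have h1 : localSmoothness A.F A.G (b' (t + 1)) (s' (t + 1)) x (state A s s' b' (t + 1)).1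
    ≤ (state A s s' b' (t + 1)).2 := le_max_right _ _
  set y := (state A s s' b' (t + 1)).1
  rcases eq_or_ne y x with e | e
  · rw [e]; simp [batchMean, linErr]
  · have h2 : 0 < ‖y - x‖ ^ 2 := by have := norm_pos_iff.2 (sub_ne_zero.2 e); positivity
    rw [localSmoothness_eq, div_le_iff₀ h2] at h1
    linarith

namespace Setting

variable [MeasurableSpace E] [CompleteSpace E] [MeasurableSpace Ξ] {μ : Measure Ξ}
  {A : Input E Ξ} {f : E → ℝ} {gradf : E → E} {σ Lhat Lbar : ℝ}

section Random

variable (h : Setting μ A f gradf σ Lhat Lbar)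
include h

lemma state_snd_pos (s s' : ℕ → ℕ → Ξ) (b' : ℕ → ℕ) (t : ℕ) : 0 < (state A s s' b' t).2 :=
  h.L₀_pos.trans_le (L₀_le_state_snd A s s' b' t)

lemma abs_batchMean_linErr_le {b : ℕ} {s : ℕ → Ξ}
    (hs : ∀ j, ∀ x ∈ A.X, ∀ y ∈ A.X, |linErr A x y (s j)| ≤ Lhat / 2 * ‖y - x‖ ^ 2)
    {x y : E} (hx : x ∈ A.X) (hy : y ∈ A.X) :
    |batchMean b (linErr A x y) s| ≤ Lhat / 2 * ‖y - x‖ ^ 2 := by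
  have hL := h.Lhat_pos
  unfold batchMean
  rw [smul_eq_mul, abs_mul, abs_inv, Nat.abs_cast]
  rcases Nat.eq_zero_or_pos b with rfl | hb
  · simp; positivity
  rw [inv_mul_le_iff₀ (by exact_mod_cast hb)]
  refine (Finset.abs_sum_le_sum_abs _ _).trans
    ((Finset.sum_le_sum fun j _ => hs j x hx y hy).trans ?_)
  simp

/-- If the linearization errors of all samples are bounded as they almost surely are, then so are
the smoothness estimates. -/
lemma state_snd_le {s s' : ℕ → ℕ → Ξ}
    (hs : ∀ t j, ∀ x ∈ A.X, ∀ y ∈ A.X, |linErr A x y (s' t j)| ≤ Lhat / 2 * ‖y - x‖ ^ 2)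
    (b' : ℕ → ℕ) (t : ℕ) : (state A s s' b' t).2 ≤ Lhat := by
  induction t with
  | zero => exact h.L₀_le
  | succ t ih =>
    refine max_le ih ?_
    have hx := h.state_mem s s' b' t
    have hy := h.state_mem s s' b' (t + 1)
    change localSmoothness A.F A.G (b' (t + 1)) (s' (t + 1)) (state A s s' b' t).1
      (state A s s' b' (t + 1)).1 ≤ Lhat
    rw [localSmoothness_eq]
    have h1 := (abs_le.1 (h.abs_batchMean_linErr_le (b := b' (t + 1)) (hs (t + 1)) hx hy)).2
    refine div_le_of_le_mul₀ (by positivity) h.Lhat_pos.le ?_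
    linarith

variable [BorelSpace E] [SecondCountableTopology E] {Ω : Type*} {mΩ : MeasurableSpace Ω}

lemma measurable_G_comp {x : Ω → E} (hx : Measurable x) (hxX : ∀ ω, x ω ∈ A.X) {y : Ω → Ξ}
    (hy : Measurable y) : Measurable fun ω => A.G (x ω) (y ω) :=
  measurable_comp_of_continuousOn h.unbiased.measurable h.continuousOn_G hx hxX hy

lemma measurable_linErr_comp {x y : Ω → E} (hx : Measurable x) (hxX : ∀ ω, x ω ∈ A.X)
    (hy : Measurable y) (hyX : ∀ ω, y ω ∈ A.X) {z : Ω → Ξ} (hz : Measurable z) :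
    Measurable fun ω => linErr A (x ω) (y ω) (z ω) :=
  ((measurable_comp_of_continuousOn h.smooth.measurable h.continuousOn_F hy hyX hz).sub
    (measurable_comp_of_continuousOn h.smooth.measurable h.continuousOn_F hx hxX hz)).sub
    ((h.measurable_G_comp hx hxX hz).inner (hy.sub hx))

/-- The first batch mean and the next iterate are measurable with respect to any σ-algebra for
which the current state and the first batch are. -/
lemma measurable_fst_batchMean {x : Ω → E} (hx : Measurable x) (hxX : ∀ ω, x ω ∈ A.X)
    {γ : Ω → ℝ} (hγ : Measurable γ) {s : Ω → ℕ → Ξ} (hs : ∀ j, Measurable fun ω => s ω j)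
    (t : ℕ) : Measurable fun ω => batchMean (A.rule.size t (γ ω)) (A.G (x ω)) (s ω) :=
  measurable_batchMean (fun j => h.measurable_G_comp hx hxX (hs j))
    ((A.rule.measurable_size t).comp hγ)

/-- The noise of the first batch, as a function of the current point, the stepsize parameter and the
samples. -/
lemma measurable_noise_prod (t : ℕ) : Measurable fun p : (A.X × ℝ) × (ℕ → Ξ) =>
    batchMean (A.rule.size t p.1.2) (A.G p.1.1) p.2 - gradf p.1.1 := by
  have m1 : Measurable fun p : (A.X × ℝ) × (ℕ → Ξ) => (p.1.1 : E) := by fun_prop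
  have m2 : Measurable fun p : (A.X × ℝ) × (ℕ → Ξ) => p.1.2 := by fun_prop
  exact (h.measurable_fst_batchMean m1 (fun p => p.1.1.2) m2 (s := fun p => p.2)
    (fun j => by fun_prop) t).sub
    (measurable_comp_continuousOn h.gradf_continuousOn m1 (fun p => p.1.1.2))

/-- The error of the second batch, as a function of the two points, the batch size and the
samples. -/
lemma measurable_linErrNoise_prod : Measurable fun p : ((A.X × A.X) × ℕ) × (ℕ → Ξ) =>
    f p.1.1.2 - f p.1.1.1 - inner ℝ (gradf p.1.1.1) ((p.1.1.2 : E) - p.1.1.1)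
      - batchMean p.1.2 (linErr A p.1.1.1 p.1.1.2) p.2 := by
  have m1 : Measurable fun p : ((A.X × A.X) × ℕ) × (ℕ → Ξ) => (p.1.1.1 : E) := by fun_prop
  have m2 : Measurable fun p : ((A.X × A.X) × ℕ) × (ℕ → Ξ) => (p.1.1.2 : E) := by fun_prop
  have m3 : Measurable fun p : ((A.X × A.X) × ℕ) × (ℕ → Ξ) => p.1.2 := by fun_prop
  have m4 : ∀ j, Measurable fun p : ((A.X × A.X) × ℕ) × (ℕ → Ξ) => p.2 j := fun j => by fun_prop
  have m5 := measurable_comp_continuousOn h.continuousOn_f m1 fun p => p.1.1.1.2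
  have m6 := measurable_comp_continuousOn h.continuousOn_f m2 fun p => p.1.1.2.2
  have m7 := measurable_comp_continuousOn h.gradf_continuousOn m1 fun p => p.1.1.1.2
  have m8 : ∀ j, Measurable fun p : ((A.X × A.X) × ℕ) × (ℕ → Ξ) =>
      linErr A p.1.1.1 p.1.1.2 (p.2 j) := fun j =>
    h.measurable_linErr_comp m1 (fun p => p.1.1.1.2) m2 (fun p => p.1.1.2.2) (m4 j)
  have m9 := measurable_batchMean (h := fun p : ((A.X × A.X) × ℕ) × (ℕ → Ξ) =>
    linErr A p.1.1.1 p.1.1.2) (s := fun p => p.2) m8 m3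
  exact ((m6.sub m5).sub (m7.inner (m2.sub m1))).sub m9

lemma measurable_state_fst_succ {s s' : Ω → ℕ → ℕ → Ξ} {b' : Ω → ℕ → ℕ} {t : ℕ}
    (ht : Measurable fun ω => state A (s ω) (s' ω) (b' ω) t)
    (hs : ∀ j, Measurable fun ω => s ω (t + 1) j) :
    Measurable fun ω => (state A (s ω) (s' ω) (b' ω) (t + 1)).1 :=
  measurable_proxPoint h.compact h.convex h.nonempty ht.fst
    (h.measurable_fst_batchMean ht.fst (fun _ => h.state_mem _ _ _ t) (ht.snd.const_mul 2) hs
      (t + 1)) (ht.snd.const_mul 2)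
    (fun ω => mul_pos two_pos (h.state_snd_pos (s ω) (s' ω) (b' ω) t))

lemma measurable_state {s s' : Ω → ℕ → ℕ → Ξ} {b' : Ω → ℕ → ℕ} (t : ℕ)
    (hs : ∀ u ≤ t, ∀ j, Measurable fun ω => s ω u j)
    (hs' : ∀ u ≤ t, ∀ j, Measurable fun ω => s' ω u j)
    (hb : ∀ u ≤ t, Measurable fun ω => b' ω u) :
    Measurable fun ω => state A (s ω) (s' ω) (b' ω) t := by
  induction t with
  | zero => exact measurable_const
  | succ t ih =>
    have ht := ih (fun u hu => hs u (by omega)) (fun u hu => hs' u (by omega))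
      (fun u hu => hb u (by omega))
    have h1 := h.measurable_state_fst_succ ht (hs (t + 1) le_rfl)
    refine h1.prodMk (ht.snd.max ?_)
    change Measurable fun ω => localSmoothness A.F A.G (b' ω (t + 1)) (s' ω (t + 1))
      (state A (s ω) (s' ω) (b' ω) t).1 (state A (s ω) (s' ω) (b' ω) (t + 1)).1
    simp only [localSmoothness_eq]
    refine Measurable.div (Measurable.const_mul ?_ 2) ((h1.sub ht.fst).norm.pow_const 2)
    exact measurable_batchMean (fun j => h.measurable_linErr_comp ht.fst
      (fun _ => h.state_mem _ _ _ t) h1 (fun _ => h.state_mem _ _ _ (t + 1))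
      (hs' (t + 1) le_rfl j)) (hb (t + 1) le_rfl)

end Random

end Setting

end ACSPG

/-! ### The expected size of the projected gradients of a trial -/

namespace ACSPG

section Samples

variable {Ξ Ω : Type*} [MeasurableSpace Ξ] {R K : ℕ} {S : Label R K → Ω → Ξ}

lemma sampleSigma_le [MeasurableSpace Ω] (hS : ∀ i, Measurable (S i)) (I : Set (Label R K)) :
    sampleSigma S I ≤ ‹MeasurableSpace Ω› :=
  iSup₂_le fun i _ => (hS i).comap_le

lemma sampleSigma_mono {I J : Set (Label R K)} (hIJ : I ⊆ J) :
    sampleSigma S I ≤ sampleSigma S J :=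
  biSup_mono fun _ hi => hIJ hi

lemma measurable_sample {I : Set (Label R K)} {i : Label R K} (hi : i ∈ I) :
    Measurable[sampleSigma S I] (S i) := by
  have h : MeasurableSpace.comap (S i) inferInstance ≤ sampleSigma S I :=
    le_iSup₂ (f := fun i (_ : i ∈ I) => MeasurableSpace.comap (S i) inferInstance) i hi
  exact (comap_measurable (S i)).mono h le_rfl

lemma measurable_pi_sample {ι : Type*} {I : Set (Label R K)} {lab : ι → Label R K}
    (hlab : ∀ j, lab j ∈ I) : Measurable[sampleSigma S I] fun ω j => S (lab j) ω :=
  @measurable_pi_lambda _ _ _ (sampleSigma S I) _ _ fun j => measurable_sample (hlab j)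

/-- Random elements that are determined by disjoint sets of samples are independent. -/
lemma indepFun_of_disjoint [MeasurableSpace Ω] {P : Measure Ω} (hS : ∀ i, Measurable (S i))
    (hind : iIndepFun S P)
    {I J : Set (Label R K)} (hIJ : Disjoint I J) {α β : Type*} [MeasurableSpace α]
    [MeasurableSpace β] {U : Ω → α} {Y : Ω → β} (hU : Measurable[sampleSigma S I] U)
    (hY : Measurable[sampleSigma S J] Y) : IndepFun U Y P := by
  rw [IndepFun_iff_Indep]
  have h := indep_iSup_of_disjoint (fun i => (hS i).comap_le)
    ((iIndepFun_iff_iIndep _ _ _).1 hind) hIJ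
  exact indep_of_indep_of_le_left (indep_of_indep_of_le_right h hY.comap_le) hU.comap_le

/-- The samples of trial `r` up to the end of iteration `t`. -/
def upTo (r : Fin R) (t : ℕ) : Set (Label R K) :=
  {i | (∃ u j, u ≤ t ∧ i = .fst r u j) ∨ (∃ u j, u ≤ t ∧ i = .snd r u j)}

lemma beforeSnd_subset_upTo (r : Fin R) {u t : ℕ} (h : u ≤ t) :
    (beforeSnd r u : Set (Label R K)) ⊆ upTo r t := by
  rintro i (⟨v, j, hv, rfl⟩ | ⟨v, j, hv, rfl⟩)
  · exact Or.inl ⟨v, j, hv.trans h, rfl⟩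
  · exact Or.inr ⟨v, j, hv.le.trans h, rfl⟩

lemma upTo_subset_beforeSnd (r : Fin R) (t : ℕ) :
    (upTo r t : Set (Label R K)) ⊆ beforeSnd r (t + 1) := by
  rintro i (⟨v, j, hv, rfl⟩ | ⟨v, j, hv, rfl⟩)
  · exact Or.inl ⟨v, j, by omega, rfl⟩
  · exact Or.inr ⟨v, j, by omega, rfl⟩

end Samples

section Batch

variable {Ξ Ω : Type*} [MeasurableSpace Ξ] [MeasurableSpace Ω] {P : Measure Ω} {μ : Measure Ξ}
  {S : ℕ → Ω → Ξ}

section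

variable {V : Type*} [NormedAddCommGroup V]

lemma integrable_sample (hS : ∀ i, Measurable (S i)) (hlaw : ∀ i, P.map (S i) = μ) {g : Ξ → V}
    (hg : Integrable g μ) (j : ℕ) : Integrable (fun ω => g (S j ω)) P := by
  rw [← hlaw j] at hg
  exact hg.comp_measurable (hS j)

variable [NormedSpace ℝ V]

lemma integral_sample (hS : ∀ i, Measurable (S i)) (hlaw : ∀ i, P.map (S i) = μ) {g : Ξ → V}
    (hg : Integrable g μ) (j : ℕ) : ∫ ω, g (S j ω) ∂P = ∫ ξ, g ξ ∂μ := by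
  rw [← hlaw j, integral_map (hS j).aemeasurable]
  rw [hlaw j]
  exact hg.aestronglyMeasurable

lemma integrable_batchMean (hS : ∀ i, Measurable (S i)) (hlaw : ∀ i, P.map (S i) = μ) {g : Ξ → V}
    (hg : Integrable g μ) (b : ℕ) : Integrable (fun ω => batchMean b g (fun j => S j ω)) P :=
  Integrable.smul _ (integrable_finsetSum _ fun j _ => integrable_sample hS hlaw hg j)

lemma integral_batchMean (hS : ∀ i, Measurable (S i)) (hlaw : ∀ i, P.map (S i) = μ) {g : Ξ → V}
    (hg : Integrable g μ) {b : ℕ} (hb : 1 ≤ b) :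
    ∫ ω, batchMean b g (fun j => S j ω) ∂P = ∫ ξ, g ξ ∂μ := by
  unfold batchMean
  rw [integral_smul, integral_finsetSum _ fun j _ => integrable_sample hS hlaw hg j,
    Finset.sum_congr rfl fun j _ => integral_sample hS hlaw hg j,
    Finset.sum_const, Finset.card_range, ← Nat.cast_smul_eq_nsmul ℝ, smul_smul,
    inv_mul_cancel₀ (by positivity), one_smul]

end

variable {E : Type*} [NormedAddCommGroup E] [InnerProductSpace ℝ E] [CompleteSpace E]
  [MeasurableSpace E] [BorelSpace E] [SecondCountableTopology E]

/-- The variance of a mini-batch mean. -/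
lemma lintegral_norm_batchMean_sub_sq_le [IsProbabilityMeasure P]
    (hS : ∀ i, Measurable (S i)) (hlaw : ∀ i, P.map (S i) = μ) (hind : iIndepFun S P)
    {g : Ξ → E} {m : E} {V : ℝ} (hgm : Measurable g) (hg : Integrable g μ) (hmean : ∫ ξ, g ξ ∂μ = m)
    (hsq : Integrable (fun ξ => ‖g ξ - m‖ ^ 2) μ) (hV : ∫ ξ, ‖g ξ - m‖ ^ 2 ∂μ ≤ V) {b : ℕ}
    (hb : 1 ≤ b) :
    ∫⁻ ω, ENNReal.ofReal (‖batchMean b g (fun j => S j ω) - m‖ ^ 2) ∂P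
      ≤ ENNReal.ofReal (V / b) := by
  have hμ : IsProbabilityMeasure μ := hlaw 0 ▸ Measure.isProbabilityMeasure_map (hS 0).aemeasurable
  have hb0 : (0 : ℝ) < b := by exact_mod_cast hb
  have hgm' : Measurable fun ξ => g ξ - m := hgm.sub measurable_const
  have hmean0 : ∫ ξ, (g ξ - m) ∂μ = 0 := by
    rw [integral_sub hg (integrable_const _), hmean]; simp
  have h1 := lintegral_norm_sum_sq_le (P := P) (ζ := fun i ω => g (S i ω) - m)
    (fun i => hgm'.comp (hS i)) (hind.comp (fun _ ξ => g ξ - m) fun _ => hgm')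
    (fun i => integrable_sample hS hlaw (hg.sub (integrable_const m)) i)
    (fun i => (integral_sample hS hlaw (hg.sub (integrable_const m)) i).trans hmean0)
    (fun i => integrable_sample hS hlaw hsq i)
    (fun i => (integral_sample hS hlaw hsq i).trans_le hV)
    (Finset.range b)
  have e : ∀ ω, ‖batchMean b g (fun j => S j ω) - m‖ ^ 2
      = (b : ℝ)⁻¹ ^ 2 * ‖∑ j ∈ Finset.range b, (g (S j ω) - m)‖ ^ 2 := fun ω => by
    have : batchMean b g (fun j => S j ω) - m
        = (b : ℝ)⁻¹ • ∑ j ∈ Finset.range b, (g (S j ω) - m) := by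
      rw [Finset.sum_sub_distrib, smul_sub, Finset.sum_const, Finset.card_range,
        ← Nat.cast_smul_eq_nsmul ℝ, smul_smul, inv_mul_cancel₀ hb0.ne', one_smul]
      rfl
    rw [this, norm_smul, mul_pow, Real.norm_of_nonneg (by positivity)]
  simp only [e]
  simp_rw [ENNReal.ofReal_mul (sq_nonneg _)]
  rw [lintegral_const_mul' _ _ ENNReal.ofReal_ne_top]
  refine (mul_le_mul_right h1 _).trans ?_
  rw [Finset.card_range, ← ENNReal.ofReal_natCast, ← ENNReal.ofReal_mul hb0.le,
    ← ENNReal.ofReal_mul (by positivity)]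
  apply ENNReal.ofReal_le_ofReal
  apply le_of_eq
  field_simp

end Batch

section Noise

/-- The bound on the weighted variance of the gradient estimate of iteration `t + 1`. -/
noncomputable def noiseBound (rule : BatchRule) (σ L₀ : ℝ) (t : ℕ) : ℝ :=
  match rule with
  | .adaptive α => σ ^ 2 / α
  | .constant b => (3 * (t : ℝ) + 2) * σ ^ 2 / (4 * (b : ℝ) * L₀)

lemma noiseBound_nonneg {rule : BatchRule} (hr : rule.Valid) {σ L₀ : ℝ} (hL : 0 < L₀) (t : ℕ) :
    0 ≤ noiseBound rule σ L₀ t := by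
  cases rule with
  | adaptive α => have : 0 < α := hr; simp only [noiseBound]; positivity
  | constant b => simp only [noiseBound]; positivity

lemma weight_mul_variance_le {rule : BatchRule} (hr : rule.Valid) {σ L₀ γ : ℝ} (hL : 0 < L₀)
    (hγ : 2 * L₀ ≤ γ) (t : ℕ) :
    (3 * (t : ℝ) + 2) / (2 * γ) * (σ ^ 2 / rule.size (t + 1) γ) ≤ noiseBound rule σ L₀ t := by
  have hγ0 : 0 < γ := by linarith
  cases rule with
  | adaptive α =>
    have hα : 0 < α := hr
    simp only [noiseBound, BatchRule.size]
    set N := max 1 ⌈(3 * ((t + 1 : ℕ) : ℝ) - 1) * α / (2 * γ)⌉₊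
    have h1 : (3 * (t : ℝ) + 2) * α / (2 * γ) ≤ N := by
      have e : (3 * (t : ℝ) + 2) = 3 * ((t + 1 : ℕ) : ℝ) - 1 := by push_cast; ring
      rw [e]
      exact (Nat.le_ceil _).trans (Nat.cast_le.2 (le_max_right _ _))
    have hN : (0 : ℝ) < N := lt_of_lt_of_le (by positivity) h1
    rw [mul_div_assoc', div_le_div_iff₀ hN hα]
    calc _ = σ ^ 2 * ((3 * (t : ℝ) + 2) * α / (2 * γ)) := by ring
      _ ≤ _ := by gcongr
  | constant b =>
    have hb : (1 : ℝ) ≤ b := by exact_mod_cast (show 1 ≤ b from hr)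
    simp only [noiseBound, BatchRule.size]
    rw [div_mul_div_comm]
    refine div_le_div_of_nonneg_left (by positivity) (by positivity) ?_
    nlinarith

lemma Q_eq (rule : BatchRule) (k : ℕ) (Lhat D σ L₀ : ℝ) :
    Q rule k Lhat D σ L₀
      = ((k : ℝ) + 1) * Lhat * D ^ 2 + ∑ t ∈ Finset.range k, noiseBound rule σ L₀ t := by
  cases rule with
  | adaptive α => simp [Q, noiseBound]; ring
  | constant b =>
    simp only [Q, noiseBound]
    congr 1
    induction k with
    | zero => simp
    | succ k ih => rw [Finset.sum_range_succ, ← ih]; push_cast; ring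

end Noise

end ACSPG

namespace ACSPG

section Independence

variable {E Ξ Ω : Type*} [NormedAddCommGroup E] [InnerProductSpace ℝ E] {R K : ℕ}
  [MeasurableSpace Ξ] [MeasurableSpace Ω] {μ : Measure Ξ} {P : Measure Ω} {A : Input E Ξ} {k : ℕ}
  {S : Label R K → Ω → Ξ} {b' : Fin R → ℕ → Ω → ℕ} {ρ : Fin R → Ω → ℕ} {sel : Ω → Fin R}
  (hrun : IsTwoPhaseRun μ P A k S b' ρ sel)
include hrun

/-- The samples of the first batch of iteration `t + 1` are independent of the current state. -/
lemma indepFun_trialState_fst (r : Fin R) (t : ℕ) {α : Type*} [MeasurableSpace α] {U : Ω → α}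
    (hU : Measurable[sampleSigma S (upTo r t)] U) :
    IndepFun U (fun ω j => S (.fst r (t + 1) j) ω) P := by
  refine indepFun_of_disjoint hrun.sample_measurable hrun.sample_indep
    (J := {i | ∃ j, i = .fst r (t + 1) j}) ?_ hU (measurable_pi_sample fun j => ⟨j, rfl⟩)
  rw [Set.disjoint_left]
  rintro i (⟨u, j, hu, rfl⟩ | ⟨u, j, hu, rfl⟩) ⟨j', hj'⟩
  · simp only [Label.fst.injEq] at hj'; omega
  · simp at hj'

/-- The samples of the second batch of iteration `t` are independent of all that precedes
them. -/
lemma indepFun_beforeSnd (r : Fin R) (t : ℕ) {α : Type*} [MeasurableSpace α] {U : Ω → α}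
    (hU : Measurable[sampleSigma S (beforeSnd r t)] U) :
    IndepFun U (fun ω j => S (.snd r t j) ω) P := by
  refine indepFun_of_disjoint hrun.sample_measurable hrun.sample_indep
    (J := {i | ∃ j, i = .snd r t j}) ?_ hU (measurable_pi_sample fun j => ⟨j, rfl⟩)
  rw [Set.disjoint_left]
  rintro i (⟨u, j, hu, rfl⟩ | ⟨u, j, hu, rfl⟩) ⟨j', hj'⟩
  · simp at hj'
  · simp only [Label.snd.injEq] at hj'; omega

end Independence

section Trial

variable {E Ξ Ω : Type*} [NormedAddCommGroup E] [InnerProductSpace ℝ E] {R K : ℕ}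

/-- The state of trial `r` after `t` iterations, as a random element. Its second component is the
maximum of the estimates so far, so that `2 * (trialState A S b' r t ω).2` is the parameter
`γ_{t + 1}` of the next iteration. -/
noncomputable def trialState (A : Input E Ξ) (S : Label R K → Ω → Ξ) (b' : Fin R → ℕ → Ω → ℕ)
    (r : Fin R) (t : ℕ) (ω : Ω) : E × ℝ :=
  state A (fun u j => S (.fst r u j) ω) (fun u j => S (.snd r u j) ω) (fun u => b' r u ω) t

/-- The gradient estimate of iteration `t + 1` of trial `r`. -/
noncomputable def gradEst (A : Input E Ξ) (S : Label R K → Ω → Ξ) (b' : Fin R → ℕ → Ω → ℕ)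
    (r : Fin R) (t : ℕ) (ω : Ω) : E :=
  batchMean (A.rule.size (t + 1) (2 * (trialState A S b' r t ω).2))
    (A.G (trialState A S b' r t ω).1) (fun j => S (.fst r (t + 1) j) ω)

/-- The error of the gradient estimate of iteration `t + 1` of trial `r`. -/
noncomputable def gradNoise (A : Input E Ξ) (gradf : E → E) (S : Label R K → Ω → Ξ)
    (b' : Fin R → ℕ → Ω → ℕ) (r : Fin R) (t : ℕ) (ω : Ω) : E :=
  gradEst A S b' r t ω - gradf (trialState A S b' r t ω).1

/-- The estimate of the linearization error of `f` between the iterates `t` and `t + 1` of trial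
`r` that the second batch provides. -/
noncomputable def linErrEst (A : Input E Ξ) (S : Label R K → Ω → Ξ) (b' : Fin R → ℕ → Ω → ℕ)
    (r : Fin R) (t : ℕ) (ω : Ω) : ℝ :=
  batchMean (b' r (t + 1) ω) (linErr A (trialState A S b' r t ω).1
    (trialState A S b' r (t + 1) ω).1) (fun j => S (.snd r (t + 1) j) ω)

/-- The error of the estimate `linErrEst`. -/
noncomputable def linErrNoise (A : Input E Ξ) (f : E → ℝ) (gradf : E → E) (S : Label R K → Ω → Ξ)
    (b' : Fin R → ℕ → Ω → ℕ) (r : Fin R) (t : ℕ) (ω : Ω) : ℝ :=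
  f (trialState A S b' r (t + 1) ω).1 - f (trialState A S b' r t ω).1
    - inner ℝ (gradf (trialState A S b' r t ω).1)
      ((trialState A S b' r (t + 1) ω).1 - (trialState A S b' r t ω).1)
    - linErrEst A S b' r t ω

/-- The sum of the squared projected gradients along trial `r`, with the weights that define the
output index. -/
noncomputable def weightedSum (A : Input E Ξ) (gradf : E → E) (S : Label R K → Ω → Ξ)
    (b' : Fin R → ℕ → Ω → ℕ) (k : ℕ) (r : Fin R) (ω : Ω) : ℝ :=
  ∑ t ∈ Finset.range k, (t : ℝ) / (4 * (2 * (trialState A S b' r t ω).2))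
    * ‖projGrad A.X (trialState A S b' r t ω).1 (gradf (trialState A S b' r t ω).1)
        (2 * (trialState A S b' r t ω).2)‖ ^ 2

variable [CompleteSpace E] [MeasurableSpace E] [MeasurableSpace Ξ] {μ : Measure Ξ}
  {A : Input E Ξ} {f : E → ℝ} {gradf : E → E} {σ Lhat Lbar : ℝ} {k : ℕ}
  {S : Label R K → Ω → Ξ} {b' : Fin R → ℕ → Ω → ℕ} {ρ : Fin R → Ω → ℕ} {sel : Ω → Fin R}
  (h : Setting μ A f gradf σ Lhat Lbar)
include h

lemma trialState_mem (r : Fin R) (t : ℕ) (ω : Ω) : (trialState A S b' r t ω).1 ∈ A.X :=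
  h.state_mem _ _ _ t

variable [MeasurableSpace Ω] {P : Measure Ω} (hrun : IsTwoPhaseRun μ P A k S b' ρ sel)
include hrun

/-- Almost surely, all stepsize estimates are at most `Lhat`, and the linearization errors of all
second batches at most `Lhat / 2` times the squared length of the step. -/
lemma ae_sample_bound : ∀ᵐ ω ∂P, ∀ r t, (trialState A S b' r t ω).2 ≤ Lhat ∧
    |linErrEst A S b' r t ω| ≤ Lhat / 2
      * ‖(trialState A S b' r (t + 1) ω).1 - (trialState A S b' r t ω).1‖ ^ 2 := by
  have h1 : ∀ i, ∀ᵐ ω ∂P, ∀ x ∈ A.X, ∀ y ∈ A.X,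
      |linErr A x y (S i ω)| ≤ Lhat / 2 * ‖y - x‖ ^ 2 := fun i => by
    have := h.ae_abs_linErr_le
    rw [← hrun.sample_law i] at this
    exact ae_of_ae_map (hrun.sample_measurable i).aemeasurable this
  have h2 : ∀ᵐ ω ∂P, ∀ (r : Fin R) (t j : ℕ), ∀ x ∈ A.X, ∀ y ∈ A.X,
      |linErr A x y (S (.snd r t j) ω)| ≤ Lhat / 2 * ‖y - x‖ ^ 2 :=
    ae_all_iff.2 fun r => ae_all_iff.2 fun t => ae_all_iff.2 fun j => h1 _
  filter_upwards [h2] with ω hω r t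
  exact ⟨h.state_snd_le (hω r) _ t, h.abs_batchMean_linErr_le (hω r (t + 1))
    (trialState_mem h r t ω) (trialState_mem h r (t + 1) ω)⟩

variable [BorelSpace E] [SecondCountableTopology E]

lemma measurable_trialState (r : Fin R) (t : ℕ) :
    Measurable[sampleSigma S (upTo r t)] (trialState A S b' r t) := by
  refine h.measurable_state (mΩ := sampleSigma S (upTo r t)) t (fun u hu j => ?_)
    (fun u hu j => ?_) (fun u hu => ?_)
  · exact measurable_sample (Or.inl ⟨u, j, hu, rfl⟩)
  · exact measurable_sample (Or.inr ⟨u, j, hu, rfl⟩)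
  · exact (hrun.snd_size_measurable r u).mono (sampleSigma_mono (beforeSnd_subset_upTo r hu)) le_rfl

lemma measurable_trialState' (r : Fin R) (t : ℕ) : Measurable (trialState A S b' r t) :=
  (measurable_trialState h hrun r t).mono (sampleSigma_le hrun.sample_measurable _) le_rfl

lemma measurable_trialState_fst_succ (r : Fin R) (t : ℕ) :
    Measurable[sampleSigma S (beforeSnd r (t + 1))] fun ω => (trialState A S b' r (t + 1) ω).1 := by
  refine h.measurable_state_fst_succ (mΩ := sampleSigma S (beforeSnd r (t + 1)))
    ((measurable_trialState h hrun r t).mono (sampleSigma_mono (upTo_subset_beforeSnd r t)) le_rfl)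
    (fun j => measurable_sample (Or.inl ⟨t + 1, j, le_rfl, rfl⟩))

lemma measurable_gradEst (r : Fin R) (t : ℕ) : Measurable (gradEst A S b' r t) :=
  have hst := measurable_trialState' h hrun r t
  h.measurable_fst_batchMean hst.fst (fun ω => trialState_mem h r t ω) (hst.snd.const_mul 2)
    (fun _ => hrun.sample_measurable _) (t + 1)

lemma measurable_gradNoise (r : Fin R) (t : ℕ) :
    Measurable (gradNoise A gradf S b' r t) :=
  (measurable_gradEst h hrun r t).sub (measurable_comp_continuousOn h.gradf_continuousOn
    (measurable_trialState' h hrun r t).fst (fun ω => trialState_mem h r t ω))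

lemma measurable_current (r : Fin R) (t : ℕ) :
    Measurable[sampleSigma S (upTo r t)] fun ω =>
      ((⟨(trialState A S b' r t ω).1, trialState_mem h r t ω⟩, 2 * (trialState A S b' r t ω).2) :
        A.X × ℝ) :=
  have hst := measurable_trialState h hrun r t
  (hst.fst.subtype_mk (h := fun ω => trialState_mem h r t ω)).prodMk (hst.snd.const_mul 2)

variable [IsProbabilityMeasure P]

lemma lintegral_weight_mul_noise_le {w : ℝ → ℝ} (hw : Measurable w) (hw0 : ∀ γ, 0 < γ → 0 ≤ w γ)
    (r : Fin R) (t : ℕ) :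
    ∫⁻ ω, ENNReal.ofReal (w (2 * (trialState A S b' r t ω).2)
        * ‖gradNoise A gradf S b' r t ω‖ ^ 2) ∂P
      ≤ ∫⁻ ω, ENNReal.ofReal (w (2 * (trialState A S b' r t ω).2)
        * (σ ^ 2 / A.rule.size (t + 1) (2 * (trialState A S b' r t ω).2))) ∂P := by
  let F : (A.X × ℝ) × (ℕ → Ξ) → ENNReal := fun p => ENNReal.ofReal (w p.1.2
    * ‖batchMean (A.rule.size (t + 1) p.1.2) (A.G p.1.1) p.2 - gradf p.1.1‖ ^ 2)
  have hUm := measurable_current h hrun r t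
  have hF : Measurable F := by
    have m2 : Measurable fun p : (A.X × ℝ) × (ℕ → Ξ) => p.1.2 := by fun_prop
    exact ((hw.comp m2).mul ((h.measurable_noise_prod (t + 1)).norm.pow_const 2)).ennreal_ofReal
  have e := lintegral_indepFun_eq (hUm.mono (sampleSigma_le hrun.sample_measurable _) le_rfl)
    (measurable_pi_lambda _ fun j => hrun.sample_measurable _)
    (indepFun_trialState_fst hrun r t hUm) hF
  refine (le_of_eq e).trans (lintegral_mono fun ω => ?_)
  have hx := trialState_mem h (S := S) (b' := b') r t ω
  have hγ : 0 < (trialState A S b' r t ω).2 := h.state_snd_pos _ _ _ t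
  simp only [F]
  have hw1 := hw0 _ (mul_pos two_pos hγ)
  simp_rw [ENNReal.ofReal_mul hw1]
  rw [lintegral_const_mul' _ _ ENNReal.ofReal_ne_top]
  refine mul_le_mul_right ?_ _
  refine lintegral_norm_batchMean_sub_sq_le (S := fun j => S (.fst r (t + 1) j))
    (fun j => hrun.sample_measurable _) (fun j => hrun.sample_law _)
    (hrun.sample_indep.precomp fun a b hab => by simpa using hab) (h.unbiased.measurable _ hx)
    (h.unbiased.integrable _ hx) (h.unbiased.mean _ hx) (h.variance.integrable _ hx)
    (h.variance.variance_le _ hx) (BatchRule.one_le_size h.valid _ _)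

/-- The weighted variance of the gradient estimates. -/
lemma integral_noise_le (r : Fin R) (t : ℕ) :
    Integrable (fun ω => (3 * (t : ℝ) + 2) / (2 * (2 * (trialState A S b' r t ω).2))
        * ‖gradNoise A gradf S b' r t ω‖ ^ 2) P ∧
    ∫ ω, (3 * (t : ℝ) + 2) / (2 * (2 * (trialState A S b' r t ω).2))
        * ‖gradNoise A gradf S b' r t ω‖ ^ 2 ∂P
      ≤ noiseBound A.rule σ A.L₀ t := by
  have h1 := lintegral_weight_mul_noise_le h hrun (w := fun γ => (3 * (t : ℝ) + 2) / (2 * γ))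
    (by fun_prop) (fun γ hγ => by positivity) r t
  have hnn := noiseBound_nonneg h.valid h.L₀_pos (σ := σ) t
  have h2 := h1.trans (lintegral_mono (g := fun _ => ENNReal.ofReal (noiseBound A.rule σ A.L₀ t))
    fun ω => ENNReal.ofReal_le_ofReal (weight_mul_variance_le h.valid h.L₀_pos
      (mul_le_mul_of_nonneg_left (L₀_le_state_snd A _ _ _ t) two_pos.le) t))
  simp only [lintegral_const, measure_univ, mul_one] at h2
  have hm : Measurable fun ω => (3 * (t : ℝ) + 2) / (2 * (2 * (trialState A S b' r t ω).2))
        * ‖gradNoise A gradf S b' r t ω‖ ^ 2 :=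
    (measurable_const.div (((measurable_trialState' h hrun r t).snd.const_mul 2).const_mul 2)).mul
      ((measurable_gradNoise h hrun r t).norm.pow_const 2)
  have h0 : ∀ ω, 0 ≤ (3 * (t : ℝ) + 2) / (2 * (2 * (trialState A S b' r t ω).2))
        * ‖gradNoise A gradf S b' r t ω‖ ^ 2 := fun ω => by
    have : 0 < (trialState A S b' r t ω).2 := h.state_snd_pos _ _ _ t
    positivity
  constructor
  · exact (lintegral_ofReal_ne_top_iff_integrable hm.aestronglyMeasurable
      (Filter.Eventually.of_forall h0)).1 (h2.trans_lt ENNReal.ofReal_lt_top).ne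
  · rw [integral_eq_lintegral_of_nonneg_ae (Filter.Eventually.of_forall h0) hm.aestronglyMeasurable]
    exact ENNReal.toReal_le_of_le_ofReal hnn h2

/-- The gradient estimates are conditionally unbiased. -/
lemma integral_inner_noise_eq (r : Fin R) (t : ℕ) {u : E} (hu : u ∈ A.X) :
    Integrable (fun ω => inner ℝ (gradNoise A gradf S b' r t ω)
      ((trialState A S b' r t ω).1 - u)) P ∧
    ∫ ω, inner ℝ (gradNoise A gradf S b' r t ω)
      ((trialState A S b' r t ω).1 - u) ∂P = 0 := by
  have hint : Integrable (fun ω => inner ℝ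
      (gradNoise A gradf S b' r t ω)
      ((trialState A S b' r t ω).1 - u)) P := by
    have h1 := lintegral_weight_mul_noise_le h hrun (w := fun _ => 1) (by fun_prop)
      (fun γ hγ => zero_le_one) r t
    have h2 := h1.trans (lintegral_mono (g := fun _ => ENNReal.ofReal (σ ^ 2)) fun ω =>
      ENNReal.ofReal_le_ofReal (by
        rw [one_mul]
        exact div_le_self (sq_nonneg σ)
          (by exact_mod_cast BatchRule.one_le_size h.valid _ _)))
    simp only [lintegral_const, measure_univ, mul_one, one_mul] at h2
    have hsq : Integrable (fun ω =>
        ‖gradNoise A gradf S b' r t ω‖ ^ 2) P :=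
      (lintegral_ofReal_ne_top_iff_integrable
        ((measurable_gradNoise h hrun r t).norm.pow_const 2).aestronglyMeasurable
        (Filter.Eventually.of_forall fun ω => sq_nonneg _)).1
        (h2.trans_lt ENNReal.ofReal_lt_top).ne
    refine ((hsq.add (integrable_const (Metric.diam A.X ^ 2)))).mono'
      ((measurable_gradNoise h hrun r t).inner
        ((measurable_trialState' h hrun r t).fst.sub measurable_const)).aestronglyMeasurable
      (Filter.Eventually.of_forall fun ω => ?_)
    have h3 := Metric.dist_le_diam_of_mem h.compact.isBounded
      (trialState_mem h (S := S) (b' := b') r t ω) hu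
    rw [dist_eq_norm] at h3
    have h4 := norm_inner_le_norm (𝕜 := ℝ)
      (gradNoise A gradf S b' r t ω)
      ((trialState A S b' r t ω).1 - u)
    have h5 := pow_le_pow_left₀ (norm_nonneg _) h3 2
    simp only [Pi.add_apply]
    nlinarith [sq_nonneg (‖gradNoise A gradf S b' r t ω‖
      - ‖(trialState A S b' r t ω).1 - u‖)]
  refine ⟨hint, ?_⟩
  have hUm := measurable_current h hrun r t
  have hF : Measurable fun p : (A.X × ℝ) × (ℕ → Ξ) => inner ℝ
      (batchMean (A.rule.size (t + 1) p.1.2) (A.G p.1.1) p.2 - gradf p.1.1) ((p.1.1 : E) - u) :=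
    (h.measurable_noise_prod (t + 1)).inner (by fun_prop)
  have e := integral_indepFun_eq (hUm.mono (sampleSigma_le hrun.sample_measurable _) le_rfl)
    (measurable_pi_lambda _ fun j => hrun.sample_measurable _)
    (indepFun_trialState_fst hrun r t hUm) hF hint
  refine e.trans (integral_eq_zero_of_ae (Filter.Eventually.of_forall fun ω => ?_))
  have hx := trialState_mem h (S := S) (b' := b') r t ω
  have i1 := integrable_batchMean (S := fun j => S (.fst r (t + 1) j))
    (fun j => hrun.sample_measurable _) (fun j => hrun.sample_law _) (h.unbiased.integrable _ hx)
    (A.rule.size (t + 1) (2 * (trialState A S b' r t ω).2))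
  have i2 := integral_batchMean (S := fun j => S (.fst r (t + 1) j))
    (fun j => hrun.sample_measurable _) (fun j => hrun.sample_law _) (h.unbiased.integrable _ hx)
    (BatchRule.one_le_size h.valid (t + 1) (2 * (trialState A S b' r t ω).2))
  simp only [Pi.zero_apply]
  simp_rw [real_inner_comm ((trialState A S b' r t ω).1 - u)]
  have i3 : Integrable (fun ω' => batchMean (A.rule.size (t + 1) (2 * (trialState A S b' r t ω).2))
      (A.G (trialState A S b' r t ω).1) (fun j => S (.fst r (t + 1) j) ω')
      - gradf (trialState A S b' r t ω).1) P := i1.sub (integrable_const _)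
  rw [integral_inner i3, integral_sub i1 (integrable_const _), i2, h.unbiased.mean _ hx]
  simp

/-- The estimates of the linearization errors are conditionally unbiased. -/
lemma integral_linErrNoise_eq [IsProbabilityMeasure μ] (r : Fin R) (t : ℕ) :
    Integrable (linErrNoise A f gradf S b' r t) P ∧
      ∫ ω, linErrNoise A f gradf S b' r t ω ∂P = 0 := by
  let U : Ω → (A.X × A.X) × ℕ := fun ω =>
    ((⟨(trialState A S b' r t ω).1, trialState_mem h r t ω⟩,
      ⟨(trialState A S b' r (t + 1) ω).1, trialState_mem h r (t + 1) ω⟩), b' r (t + 1) ω)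
  let Y : Ω → ℕ → Ξ := fun ω j => S (.snd r (t + 1) j) ω
  let ψ : ((A.X × A.X) × ℕ) × (ℕ → Ξ) → ℝ := fun p =>
    f p.1.1.2 - f p.1.1.1 - inner ℝ (gradf p.1.1.1) ((p.1.1.2 : E) - p.1.1.1)
      - batchMean p.1.2 (linErr A p.1.1.1 p.1.1.2) p.2
  have e : linErrNoise A f gradf S b' r t = fun ω => ψ (U ω, Y ω) := rfl
  have hy := measurable_trialState_fst_succ h hrun r t
  have hx := (measurable_trialState h hrun r t).fst.mono
    (sampleSigma_mono (upTo_subset_beforeSnd r t)) le_rfl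
  have hUm : Measurable[sampleSigma S (beforeSnd r (t + 1))] U :=
    ((hx.subtype_mk (h := fun ω => trialState_mem h r t ω)).prodMk
      (hy.subtype_mk (h := fun ω => trialState_mem h r (t + 1) ω))).prodMk
      (hrun.snd_size_measurable r (t + 1))
  have hU : Measurable U := hUm.mono (sampleSigma_le hrun.sample_measurable _) le_rfl
  have hY : Measurable Y := measurable_pi_lambda _ fun j => hrun.sample_measurable _
  have hψ : Measurable ψ := h.measurable_linErrNoise_prod
  have hint : Integrable (fun ω => ψ (U ω, Y ω)) P := by
    refine (integrable_const (Lhat * Metric.diam A.X ^ 2)).mono'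
      (hψ.comp (hU.prodMk hY)).aestronglyMeasurable ?_
    filter_upwards [ae_sample_bound h hrun] with ω hω
    change ‖linErrNoise A f gradf S b' r t ω‖ ≤ _
    have hx := trialState_mem h (S := S) (b' := b') r t ω
    have hy := trialState_mem h (S := S) (b' := b') r (t + 1) ω
    have h1 := abs_le.1 (h.abs_sub_sub_inner_le hx hy)
    have h2 := abs_le.1 (hω r t).2
    have h3 := Metric.dist_le_diam_of_mem h.compact.isBounded hy hx
    rw [dist_eq_norm] at h3
    have h4 := mul_le_mul_of_nonneg_left (pow_le_pow_left₀ (norm_nonneg _) h3 2) h.Lhat_pos.le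
    rw [Real.norm_eq_abs, abs_le, linErrNoise]
    constructor <;> linarith
  rw [e]
  refine ⟨hint, (integral_indepFun_eq hU hY (indepFun_beforeSnd hrun r (t + 1) hUm) hψ
    hint).trans (integral_eq_zero_of_ae (Filter.Eventually.of_forall fun ω => ?_))⟩
  have hx := trialState_mem h (S := S) (b' := b') r t ω
  have hy := trialState_mem h (S := S) (b' := b') r (t + 1) ω
  have hb := hrun.snd_size_pos r (t + 1) ω
  have i1 := integrable_batchMean (S := fun j => S (.snd r (t + 1) j))
    (fun j => hrun.sample_measurable _) (fun j => hrun.sample_law _) (h.integrable_linErr hx hy)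
    (b' r (t + 1) ω)
  have i2 := integral_batchMean (S := fun j => S (.snd r (t + 1) j))
    (fun j => hrun.sample_measurable _) (fun j => hrun.sample_law _) (h.integrable_linErr hx hy) hb
  simp only [Pi.zero_apply, ψ, U, Y]
  rw [integral_sub (integrable_const _) i1, i2, h.integral_linErr hx hy]
  simp

/-- The mean of the weighted sum of squared projected gradients along a trial is at most `Q`. -/
lemma lintegral_weightedSum_le [IsProbabilityMeasure μ] (r : Fin R) :
    ∫⁻ ω, ENNReal.ofReal (weightedSum A gradf S b' k r ω) ∂P
      ≤ ENNReal.ofReal (Q A.rule k Lhat (Metric.diam A.X) σ A.L₀) := by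
  obtain ⟨u, hu, hmin⟩ := h.exists_min
  set D := Metric.diam A.X
  set B : Ω → ℝ := fun ω => ((k : ℝ) + 1) * Lhat * D ^ 2
    + ∑ t ∈ Finset.range k, ((3 * (t : ℝ) + 2) / (2 * (2 * (trialState A S b' r t ω).2))
        * ‖gradNoise A gradf S b' r t ω‖ ^ 2
      + ((t : ℝ) + 1) * linErrNoise A f gradf S b' r t ω
      - inner ℝ (gradNoise A gradf S b' r t ω)
        ((trialState A S b' r t ω).1 - u)) with hB
  have hle : ∀ᵐ ω ∂P, weightedSum A gradf S b' k r ω ≤ B ω := by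
    filter_upwards [ae_sample_bound h hrun] with ω hω
    have hmem := fun t => trialState_mem h (S := S) (b' := b') r t ω
    refine sum_sq_projGrad_le (x := fun t => (trialState A S b' r t ω).1)
      (g := fun t => gradEst A S b' r t ω) (Γ := fun t => 2 * (trialState A S b' r t ω).2)
      (H := fun t => linErrEst A S b' r t ω) h.compact h.convex hmem hu hmin
      (fun y hy z hz => by
        rw [← dist_eq_norm]; exact Metric.dist_le_diam_of_mem h.compact.isBounded hy hz)
      (fun t => mul_pos two_pos (h.state_snd_pos _ _ _ t))
      (fun t => mul_le_mul_of_nonneg_left (state_snd_mono A _ _ _ t) two_pos.le) h.Lhat_pos.le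
      (fun t => rfl) (fun t => ?_)
      (fun t => batchMean_linErr_le A (fun u j => S (.fst r u j) ω) (fun u j => S (.snd r u j) ω)
        (fun u => b' r u ω) t) k
      (mul_le_mul_of_nonneg_left (hω r k).1 two_pos.le)
    have := (abs_le.1 (h.abs_sub_sub_inner_le (hmem t) hu)).1
    linarith
  have hi := fun t => integral_noise_le h hrun r t
  have hi' := fun t => integral_linErrNoise_eq h hrun r t
  have hi'' := fun t => integral_inner_noise_eq h hrun r t hu
  have hi2 : ∀ t : ℕ, Integrable (fun ω => (3 * (t : ℝ) + 2)
      / (2 * (2 * (trialState A S b' r t ω).2)) * ‖gradNoise A gradf S b' r t ω‖ ^ 2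
      + ((t : ℝ) + 1) * linErrNoise A f gradf S b' r t ω) P := fun t =>
    (hi t).1.add ((hi' t).1.const_mul ((t : ℝ) + 1))
  have hi4 : ∀ t : ℕ, Integrable (fun ω => (3 * (t : ℝ) + 2)
      / (2 * (2 * (trialState A S b' r t ω).2)) * ‖gradNoise A gradf S b' r t ω‖ ^ 2
      + ((t : ℝ) + 1) * linErrNoise A f gradf S b' r t ω
      - inner ℝ (gradNoise A gradf S b' r t ω) ((trialState A S b' r t ω).1 - u)) P := fun t =>
    (hi2 t).sub (hi'' t).1
  have hi3 : Integrable (fun ω => ∑ t ∈ Finset.range k, ((3 * (t : ℝ) + 2)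
      / (2 * (2 * (trialState A S b' r t ω).2)) * ‖gradNoise A gradf S b' r t ω‖ ^ 2
      + ((t : ℝ) + 1) * linErrNoise A f gradf S b' r t ω
      - inner ℝ (gradNoise A gradf S b' r t ω) ((trialState A S b' r t ω).1 - u))) P :=
    integrable_finsetSum _ fun t _ => hi4 t
  have hBint : Integrable B P := (integrable_const _).add hi3
  have hBQ : ∫ ω, B ω ∂P ≤ Q A.rule k Lhat D σ A.L₀ := by
    simp only [hB]
    rw [integral_add (integrable_const _) hi3,
      integral_finsetSum _ fun t _ => hi4 t, Q_eq]
    simp only [integral_const, probReal_univ, one_smul]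
    refine add_le_add_right (Finset.sum_le_sum fun t _ => ?_) _
    rw [integral_sub (hi2 t) (hi'' t).1, integral_add (hi t).1 ((hi' t).1.const_mul ((t : ℝ) + 1)),
      integral_const_mul, (hi' t).2, (hi'' t).2]
    simpa using (hi t).2
  have hW0 : ∀ ω, 0 ≤ weightedSum A gradf S b' k r ω := fun ω => Finset.sum_nonneg fun t _ => by
    have : 0 < (trialState A S b' r t ω).2 := h.state_snd_pos _ _ _ t
    positivity
  calc _ ≤ ∫⁻ ω, ENNReal.ofReal (B ω) ∂P :=
        lintegral_mono_ae (hle.mono fun ω hω => ENNReal.ofReal_le_ofReal hω)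
    _ = ENNReal.ofReal (∫ ω, B ω ∂P) := (ofReal_integral_eq_lintegral_ofReal hBint
        (hle.mono fun ω hω => (hW0 ω).trans hω)).symm
    _ ≤ _ := ENNReal.ofReal_le_ofReal hBQ

end Trial

end ACSPG

/-! ### The output indices -/

namespace ACSPG

section OutputProb

lemma sum_Icc_two_eq_sum_range (φ : ℕ → ℝ) (h1 : φ 1 = 0) (k : ℕ) :
    ∑ j ∈ Finset.Icc 2 k, φ j = ∑ i ∈ Finset.range k, φ (i + 1) := by
  induction k with
  | zero => simp
  | succ k ih =>
    rw [Finset.sum_range_succ, ← ih]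
    rcases Nat.eq_zero_or_pos k with rfl | hk
    · simp [h1]
    · rw [Finset.sum_Icc_succ_top (by omega)]

variable {γ : ℕ → ℝ} {k : ℕ}

lemma outputProb_eq_zero {i : ℕ} (hi : k ≤ i) : outputProb γ k i = 0 := by
  unfold outputProb
  rw [if_neg]
  simp only [Finset.mem_Icc]
  omega

lemma outputProb_eq {i : ℕ} (hi : i < k) :
    outputProb γ k i = (∑ j ∈ Finset.range k, (j : ℝ) / γ (j + 1))⁻¹ * ((i : ℝ) / γ (i + 1)) := by
  have e : ∑ j ∈ Finset.Icc 2 k, ((j : ℝ) - 1) / γ j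
      = ∑ j ∈ Finset.range k, (j : ℝ) / γ (j + 1) := by
    rw [sum_Icc_two_eq_sum_range (fun j => ((j : ℝ) - 1) / γ j) (by simp)]
    simp
  unfold outputProb
  rw [e]
  rcases Nat.eq_zero_or_pos i with rfl | h
  · simp
  · rw [if_pos (by simp only [Finset.mem_Icc]; omega)]

lemma M_eq : M γ k = (∑ j ∈ Finset.range k, (j : ℝ) / γ (j + 1)) / 4 := by
  unfold M
  rw [sum_Icc_two_eq_sum_range (fun j => ((j : ℝ) - 1) / (4 * γ j)) (by simp), Finset.sum_div]
  refine Finset.sum_congr rfl fun j _ => ?_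
  push_cast
  rw [div_div, add_sub_cancel_right, mul_comm]

lemma M_pos (hγ : ∀ t, 0 < γ t) (hk : 2 ≤ k) : 0 < M γ k := by
  rw [M_eq]
  have : 0 < ∑ j ∈ Finset.range k, (j : ℝ) / γ (j + 1) :=
    Finset.sum_pos' (fun j _ => by have := hγ (j + 1); positivity)
      ⟨1, by simp; omega, by have := hγ 2; simpa using this⟩
  positivity

lemma outputProb_nonneg (hγ : ∀ t, 0 < γ t) (i : ℕ) : 0 ≤ outputProb γ k i := by
  rcases lt_or_ge i k with hi | hi
  · rw [outputProb_eq hi]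
    have h1 := hγ (i + 1)
    have : 0 ≤ ∑ j ∈ Finset.range k, (j : ℝ) / γ (j + 1) :=
      Finset.sum_nonneg fun j _ => by have := hγ (j + 1); positivity
    positivity
  · rw [outputProb_eq_zero hi]

lemma sum_outputProb_le_one : ∑ i ∈ Finset.range k, outputProb γ k i ≤ 1 := by
  rw [Finset.sum_congr rfl fun i hi => outputProb_eq (Finset.mem_range.1 hi), ← Finset.mul_sum]
  exact inv_mul_le_one

lemma outputProb_mul_M (hγ : ∀ t, 0 < γ t) (hk : 2 ≤ k) {i : ℕ} (hi : i < k) :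
    outputProb γ k i * M γ k = (i : ℝ) / (4 * γ (i + 1)) := by
  have h := M_pos hγ hk
  rw [M_eq] at h ⊢
  have h1 := hγ (i + 1)
  have h2 : ∑ j ∈ Finset.range k, (j : ℝ) / γ (j + 1) ≠ 0 := by
    intro h0; rw [h0] at h; simp at h
  rw [outputProb_eq hi]
  field_simp

end OutputProb

section Index

variable {E Ξ Ω : Type*} [NormedAddCommGroup E] [InnerProductSpace ℝ E] {R K : ℕ}
variable [CompleteSpace E] [MeasurableSpace E] [MeasurableSpace Ξ] {μ : Measure Ξ}
  {A : Input E Ξ} {f : E → ℝ} {gradf : E → E} {σ Lhat Lbar : ℝ} {k : ℕ}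
  {S : Label R K → Ω → Ξ} {b' : Fin R → ℕ → Ω → ℕ} {ρ : Fin R → Ω → ℕ} {sel : Ω → Fin R}
  (h : Setting μ A f gradf σ Lhat Lbar)

/-- The samples of trial `r`. -/
def ofTrial (r : Fin R) : Set (Label R K) :=
  {i | (∃ u j, i = .fst r u j) ∨ (∃ u j, i = .snd r u j)}

lemma upTo_subset_ofTrial (r : Fin R) (t : ℕ) : (upTo r t : Set (Label R K)) ⊆ ofTrial r := by
  rintro i (⟨u, j, -, rfl⟩ | ⟨u, j, -, rfl⟩)
  · exact Or.inl ⟨u, j, rfl⟩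
  · exact Or.inr ⟨u, j, rfl⟩

include h

lemma trialGam_pos (r : Fin R) (ω : Ω) (t : ℕ) : 0 < trialGam A S b' r ω t :=
  mul_pos two_pos (h.state_snd_pos _ _ _ (t - 1))

variable [MeasurableSpace Ω] {P : Measure Ω} (hrun : IsTwoPhaseRun μ P A k S b' ρ sel)
include hrun

/-- The joint law of the output indices, on an event determined by the samples. -/
lemma measure_index_inter_eq [IsProbabilityMeasure P] (i : Fin R → ℕ) {B : Set Ω}
    (hB : MeasurableSet[sampleSigma S Set.univ] B) :
    P ({ω | ∀ r, ρ r ω = i r} ∩ B)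
      = ∫⁻ ω in B, ∏ r, ENNReal.ofReal (outputProb (trialGam A S b' r ω) k (i r)) ∂P := by
  have hle := sampleSigma_le hrun.sample_measurable (Set.univ : Set (Label R K))
  have hI : MeasurableSet {ω | ∀ r, ρ r ω = i r} := by
    rw [Set.ofPred_forall]
    exact MeasurableSet.iInter fun r => hrun.index_measurable r (measurableSet_singleton (i r))
  have hint : Integrable ({ω | ∀ r, ρ r ω = i r}.indicator fun _ => (1 : ℝ)) P :=
    (integrable_const _).indicator hI
  have h1 := setIntegral_condExp hle hint hB
  have hlaw := hrun.index_law i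
  have h2 : ∫ ω in B, ∏ r, outputProb (trialGam A S b' r ω) k (i r) ∂P
      = P.real ({ω | ∀ r, ρ r ω = i r} ∩ B) := by
    rw [← integral_congr_ae (ae_restrict_of_ae hlaw), h1, integral_indicator hI]
    simp [Measure.real, Measure.restrict_restrict hI, Measure.restrict_apply]
  have h3 : Integrable (fun ω => ∏ r, outputProb (trialGam A S b' r ω) k (i r)) P :=
    integrable_condExp.congr hlaw
  have h4 : ∀ ω r, 0 ≤ outputProb (trialGam A S b' r ω) k (i r) := fun ω r =>
    outputProb_nonneg (trialGam_pos h r ω) _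
  simp_rw [← ENNReal.ofReal_prod_of_nonneg fun r _ => h4 _ r]
  rw [← ofReal_integral_eq_lintegral_ofReal h3.integrableOn
    (Filter.Eventually.of_forall fun ω => Finset.prod_nonneg fun r _ => h4 ω r), h2,
    ofReal_measureReal]

variable [BorelSpace E] [SecondCountableTopology E]

lemma measurable_trialGam (r : Fin R) (t : ℕ) :
    Measurable[sampleSigma S (ofTrial r)] fun ω => trialGam A S b' r ω t :=
  ((measurable_trialState h hrun r (t - 1)).snd.const_mul 2).mono
    (sampleSigma_mono (upTo_subset_ofTrial r _)) le_rfl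

lemma measurable_M (r : Fin R) :
    Measurable[sampleSigma S (ofTrial r)] fun ω => M (trialGam A S b' r ω) k := by
  simp only [M]
  exact @Finset.measurable_fun_sum _ _ _ _ _ _ (sampleSigma S (ofTrial r)) _ _ fun t _ =>
    measurable_const.div ((measurable_trialGam h hrun r t).const_mul 4)

lemma measurable_outputProb (r : Fin R) (i : ℕ) :
    Measurable[sampleSigma S (ofTrial r)] fun ω => outputProb (trialGam A S b' r ω) k i := by
  rcases lt_or_ge i k with hi | hi
  · simp only [outputProb_eq hi]
    refine Measurable.mul (Measurable.inv ?_)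
      (measurable_const.div (measurable_trialGam h hrun r (i + 1)))
    exact @Finset.measurable_fun_sum _ _ _ _ _ _ (sampleSigma S (ofTrial r)) _ _ fun t _ =>
      measurable_const.div (measurable_trialGam h hrun r (t + 1))
  · simp only [outputProb_eq_zero hi]
    exact measurable_const

variable [IsProbabilityMeasure P]

/-- An event about the samples and the output indices, trial by trial: the indices can be averaged
out with the output probabilities. -/
lemma measure_index_le {C : Fin R → ℕ → Set Ω}
    (hC : ∀ r i, MeasurableSet[sampleSigma S Set.univ] (C r i)) :
    P {ω | ∀ r, ω ∈ C r (ρ r ω)} ≤ ∫⁻ ω, ∏ r, ∑ i ∈ Finset.range k,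
      ENNReal.ofReal (outputProb (trialGam A S b' r ω) k i) * (C r i).indicator 1 ω ∂P := by
  have hle := sampleSigma_le hrun.sample_measurable (Set.univ : Set (Label R K))
  have hop : ∀ r i, Measurable fun ω => ENNReal.ofReal (outputProb (trialGam A S b' r ω) k i) :=
    fun r i => ((measurable_outputProb h hrun r i).mono
      (sampleSigma_le hrun.sample_measurable _) le_rfl).ennreal_ofReal
  have hBm : ∀ i : Fin R → ℕ, MeasurableSet[sampleSigma S Set.univ] (⋂ r, C r (i r)) :=
    fun i => MeasurableSet.iInter fun r => hC r (i r)
  have hsub : {ω | ∀ r, ω ∈ C r (ρ r ω)}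
      ⊆ ⋃ i : Fin R → ℕ, ({ω | ∀ r, ρ r ω = i r} ∩ ⋂ r, C r (i r)) := fun ω hω =>
    Set.mem_iUnion.2 ⟨fun r => ρ r ω, fun r => rfl, Set.mem_iInter.2 hω⟩
  refine (measure_mono hsub).trans ((measure_iUnion_le _).trans ?_)
  rw [tsum_eq_sum (s := Fintype.piFinset fun _ => Finset.range k)]
  · simp only [Finset.prod_univ_sum]
    rw [lintegral_finsetSum _ fun i _ => Finset.measurable_fun_prod _ fun r _ =>
      (hop r (i r)).mul (measurable_one.indicator (hle _ (hC r (i r))))]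
    refine Finset.sum_le_sum fun i _ => ?_
    rw [measure_index_inter_eq h hrun i (hBm i), ← lintegral_indicator (hle _ (hBm i))]
    refine lintegral_mono fun ω => ?_
    by_cases hω : ω ∈ ⋂ r, C r (i r)
    · rw [Set.indicator_of_mem hω]
      refine Finset.prod_le_prod' fun r _ => ?_
      rw [Set.indicator_of_mem (Set.mem_iInter.1 hω r)]
      simp
    · rw [Set.indicator_of_notMem hω]
      exact zero_le
  · intro i hi
    simp only [Fintype.mem_piFinset, Finset.mem_range, not_forall, not_lt] at hi
    obtain ⟨r, hr⟩ := hi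
    rw [measure_index_inter_eq h hrun i (hBm i)]
    refine (lintegral_congr fun ω => ?_).trans lintegral_zero
    exact Finset.prod_eq_zero (Finset.mem_univ r) (by rw [outputProb_eq_zero hr]; simp)

end Index

section Independence

variable {Ξ Ω : Type*} {R K : ℕ} [MeasurableSpace Ξ] [MeasurableSpace Ω] {P : Measure Ω}
  [IsProbabilityMeasure P] {S : Label R K → Ω → Ξ}

/-- The trials are independent. -/
lemma lintegral_prod_ofTrial (hS : ∀ i, Measurable (S i)) (hind : iIndepFun S P)
    {ψ : Fin R → Ω → ENNReal} (hψ : ∀ r, Measurable[sampleSigma S (ofTrial r)] (ψ r)) :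
    ∫⁻ ω, ∏ r, ψ r ω ∂P = ∏ r, ∫⁻ ω, ψ r ω ∂P := by
  suffices ∀ s : Finset (Fin R), ∫⁻ ω, ∏ r ∈ s, ψ r ω ∂P = ∏ r ∈ s, ∫⁻ ω, ψ r ω ∂P from this _
  intro s
  induction s using Finset.induction with
  | empty => simp
  | insert r s hr ih =>
    simp only [Finset.prod_insert hr]
    rw [← ih]
    have h1 : Measurable[sampleSigma S (⋃ q ∈ s, ofTrial q)] fun ω => ∏ q ∈ s, ψ q ω :=
      @Finset.measurable_fun_prod _ _ _ _ _ _ (sampleSigma S (⋃ q ∈ s, ofTrial q)) _ _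
        fun q hq => (hψ q).mono (sampleSigma_mono (Set.subset_biUnion_of_mem
          (u := fun q => (ofTrial q : Set (Label R K))) hq)) le_rfl
    have hdisj : Disjoint (ofTrial r : Set (Label R K)) (⋃ q ∈ s, ofTrial q) := by
      rw [Set.disjoint_left]
      rintro i hi hi'
      simp only [Set.mem_iUnion] at hi'
      obtain ⟨q, hq, hi'⟩ := hi'
      have : r = q := by
        rcases hi with ⟨u, j, rfl⟩ | ⟨u, j, rfl⟩ <;> rcases hi' with ⟨u', j', e⟩ | ⟨u', j', e⟩ <;>
          simp at e <;> exact e.1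
      exact hr (this ▸ hq)
    exact lintegral_mul_eq_lintegral_mul_lintegral_of_indepFun''
      ((hψ r).mono (sampleSigma_le hS _) le_rfl).aemeasurable
      (h1.mono (sampleSigma_le hS _) le_rfl).aemeasurable
      (indepFun_of_disjoint hS hind hdisj (hψ r) h1)

end Independence

end ACSPG

/-! ### The two phases -/

namespace ACSPG

section TwoPhase

variable {E Ξ Ω : Type*} [NormedAddCommGroup E] [InnerProductSpace ℝ E] {R K : ℕ}

/-- The projected gradient `P_X(x_i, ∇f(x_i), γ_{i+1})` of trial `r`. -/
noncomputable def trialProjGrad (A : Input E Ξ) (gradf : E → E) (S : Label R K → Ω → Ξ)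
    (b' : Fin R → ℕ → Ω → ℕ) (r : Fin R) (i : ℕ) (ω : Ω) : E :=
  projGrad A.X (trialState A S b' r i ω).1 (gradf (trialState A S b' r i ω).1)
    (2 * (trialState A S b' r i ω).2)

/-- The error of the post-optimization gradient estimate at the iterate `x_i` of trial `r`. -/
noncomputable def postErr (A : Input E Ξ) (gradf : E → E) (S : Label R K → Ω → Ξ)
    (b' : Fin R → ℕ → Ω → ℕ) (r : Fin R) (i : ℕ) (ω : Ω) : E :=
  (K : ℝ)⁻¹ • ∑ j : Fin K, A.G (trialState A S b' r i ω).1 (S (.post j) ω)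
    - gradf (trialState A S b' r i ω).1

variable [CompleteSpace E] [MeasurableSpace E] [MeasurableSpace Ξ] {μ : Measure Ξ}
  [MeasurableSpace Ω] {P : Measure Ω}
  {A : Input E Ξ} {f : E → ℝ} {gradf : E → E} {σ Lhat Lbar : ℝ} {k : ℕ}
  {S : Label R K → Ω → Ξ} {b' : Fin R → ℕ → Ω → ℕ} {ρ : Fin R → Ω → ℕ} {sel : Ω → Fin R}
  (h : Setting μ A f gradf σ Lhat Lbar) (hrun : IsTwoPhaseRun μ P A k S b' ρ sel)
include h hrun

/-- If the output of some trial has a small projected gradient and all post-optimization estimates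
are accurate, then the selected output has a small projected gradient. -/
lemma norm_exactProjGrad_sq_le {q c : ℝ} (hk : 2 ≤ k) {ω : Ω} {r : Fin R}
    (hr : M (trialGam A S b' r ω) k * ‖trialProjGrad A gradf S b' r (ρ r ω) ω‖ ^ 2 ≤ 2 * q)
    (hpost : ∀ r, ‖postErr A gradf S b' r (ρ r ω) ω‖ ≤ c) :
    ‖exactProjGrad A gradf S b' ρ (sel ω) ω‖ ^ 2
      ≤ 8 * q / (⨅ r, M (trialGam A S b' r ω) k) + 16 / 3 * c ^ 2 := by
  have hMpos : ∀ r, 0 < M (trialGam A S b' r ω) k := fun r => M_pos (trialGam_pos h r ω) hk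
  have : Nonempty (Fin R) := ⟨r⟩
  have hinf : 0 < ⨅ r, M (trialGam A S b' r ω) k := by
    obtain ⟨r', hr'⟩ := exists_eq_ciInf_of_finite (f := fun r => M (trialGam A S b' r ω) k)
    rw [← hr']; exact hMpos r'
  have hinf_le : ⨅ r, M (trialGam A S b' r ω) k ≤ M (trialGam A S b' r ω) k :=
    ciInf_le (Set.finite_range _).bddBelow r
  have herr : ∀ r, ‖exactProjGrad A gradf S b' ρ r ω - sampledProjGrad A S b' ρ r ω‖ ≤ c :=
    fun r => by
      refine (norm_projGrad_sub_le h.compact h.convex h.nonempty _ _ _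
        (trialGam_pos h r ω _)).trans ?_
      rw [norm_sub_rev]
      exact hpost r
  have hc : 0 ≤ c := (norm_nonneg _).trans (herr r)
  set a := ‖exactProjGrad A gradf S b' ρ r ω‖ with ha
  have h1 : ‖exactProjGrad A gradf S b' ρ (sel ω) ω‖ ≤ a + 2 * c := by
    have t1 := norm_le_norm_add_norm_sub (sampledProjGrad A S b' ρ (sel ω) ω)
      (exactProjGrad A gradf S b' ρ (sel ω) ω)
    have t2 := norm_le_norm_add_norm_sub (exactProjGrad A gradf S b' ρ r ω)
      (sampledProjGrad A S b' ρ r ω)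
    have t3 := hrun.sel_min ω r
    have t4 := herr (sel ω)
    have t5 := herr r
    rw [norm_sub_rev] at t4
    linarith
  have h2 : a ^ 2 ≤ 2 * q / ⨅ r, M (trialGam A S b' r ω) k := by
    rw [le_div_iff₀ hinf]
    have : (⨅ r, M (trialGam A S b' r ω) k) * a ^ 2 ≤ M (trialGam A S b' r ω) k * a ^ 2 := by
      gcongr
    have hr' : M (trialGam A S b' r ω) k * a ^ 2 ≤ 2 * q := hr
    linarith
  have h3 := pow_le_pow_left₀ (norm_nonneg _) h1 2
  have e : 8 * q / (⨅ r, M (trialGam A S b' r ω) k)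
      = 4 * (2 * q / ⨅ r, M (trialGam A S b' r ω) k) := by ring
  rw [e]
  -- `(a + 2 c)² ≤ (1 + 3) a² + (1 + 1 / 3) (2 c)²`
  nlinarith [sq_nonneg (3 * a - 2 * c)]

variable [BorelSpace E] [SecondCountableTopology E]

lemma measurable_trialProjGrad (r : Fin R) (i : ℕ) :
    Measurable[sampleSigma S (ofTrial r)] (trialProjGrad A gradf S b' r i) := by
  have hst : Measurable[sampleSigma S (ofTrial r)] (trialState A S b' r i) :=
    (measurable_trialState h hrun r i).mono (sampleSigma_mono (upTo_subset_ofTrial r i)) le_rfl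
  have hg := measurable_comp_continuousOn h.gradf_continuousOn hst.fst
    (fun ω => trialState_mem h r i ω)
  have hp := measurable_proxPoint h.compact h.convex h.nonempty hst.fst hg (hst.snd.const_mul 2)
    (fun ω => mul_pos two_pos (h.state_snd_pos _ _ _ i))
  exact (hst.snd.const_mul 2).smul (hst.fst.sub hp)

variable [IsProbabilityMeasure P]

/-- With probability at least `1 - 2 ^ (-R)`, some trial outputs a point whose projected gradient is
at most twice as large, in the squared norm, as the mean bound. -/
lemma measure_forall_lt_le [IsProbabilityMeasure μ] (hk : 2 ≤ k) :
    P {ω | ∀ r, 2 * Q A.rule k Lhat (Metric.diam A.X) σ A.L₀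
        < M (trialGam A S b' r ω) k * ‖trialProjGrad A gradf S b' r (ρ r ω) ω‖ ^ 2}
      ≤ ENNReal.ofReal ((1 / 2) ^ R) := by
  set q := Q A.rule k Lhat (Metric.diam A.X) σ A.L₀ with hq
  have hqpos : 0 < q := by
    have hσ := h.variance.pos
    have h0 : 0 ≤ ((k : ℝ) + 1) * Lhat * Metric.diam A.X ^ 2 := by
      have := h.Lhat_pos; positivity
    have hk' : (2 : ℝ) ≤ k := by exact_mod_cast hk
    have hL := h.L₀_pos
    have hv := h.valid
    have : 0 < q - ((k : ℝ) + 1) * Lhat * Metric.diam A.X ^ 2 := by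
      rw [hq]
      cases hr : A.rule with
      | adaptive α =>
        rw [hr] at hv
        have : 0 < α := hv
        simp only [Q, add_sub_cancel_left]; positivity
      | constant b =>
        rw [hr] at hv
        have : 1 ≤ b := hv
        simp only [Q, add_sub_cancel_left]; positivity
    linarith
  let C : Fin R → ℕ → Set Ω := fun r i =>
    {ω | 2 * q < M (trialGam A S b' r ω) k * ‖trialProjGrad A gradf S b' r i ω‖ ^ 2}
  have hC : ∀ r i, MeasurableSet[sampleSigma S (ofTrial r)] (C r i) := fun r i =>
    ((measurable_M h hrun r).mul ((by fun_prop : Measurable fun x : E => ‖x‖ ^ 2).comp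
      (measurable_trialProjGrad h hrun r i))) measurableSet_Ioi
  refine (measure_index_le h hrun (C := C) fun r i =>
    sampleSigma_mono (Set.subset_univ _) _ (hC r i)).trans ?_
  have hψ : ∀ r, Measurable[sampleSigma S (ofTrial r)] fun ω => ∑ i ∈ Finset.range k,
      ENNReal.ofReal (outputProb (trialGam A S b' r ω) k i) * (C r i).indicator 1 ω := fun r =>
    @Finset.measurable_fun_sum _ _ _ _ _ _ (sampleSigma S (ofTrial r)) _ _ fun i _ =>
      ((measurable_outputProb h hrun r i).ennreal_ofReal).mul
        (Measurable.indicator (measurable_const (a := (1 : ENNReal))) (hC r i))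
  rw [lintegral_prod_ofTrial hrun.sample_measurable hrun.sample_indep hψ]
  have hone : ∀ r, ∫⁻ ω, ∑ i ∈ Finset.range k,
      ENNReal.ofReal (outputProb (trialGam A S b' r ω) k i) * (C r i).indicator 1 ω ∂P
      ≤ ENNReal.ofReal (1 / 2) := by
    intro r
    -- Markov's inequality, with the mean over the output index taken first
    have hpt : ∀ ω, ∑ i ∈ Finset.range k,
        ENNReal.ofReal (outputProb (trialGam A S b' r ω) k i) * (C r i).indicator 1 ω
        ≤ ENNReal.ofReal ((2 * q)⁻¹) * ENNReal.ofReal (weightedSum A gradf S b' k r ω) := by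
      intro ω
      have hγ := trialGam_pos h (S := S) (b' := b') r ω
      rw [← ENNReal.ofReal_mul (by positivity), weightedSum, Finset.mul_sum,
        ENNReal.ofReal_sum_of_nonneg]
      · refine Finset.sum_le_sum fun i hi => ?_
        by_cases hω : ω ∈ C r i
        · rw [Set.indicator_of_mem hω, Pi.one_apply, mul_one]
          apply ENNReal.ofReal_le_ofReal
          have hop := outputProb_nonneg (k := k) hγ i
          have hlt : 2 * q < M (trialGam A S b' r ω) k
            * ‖trialProjGrad A gradf S b' r i ω‖ ^ 2 := hω
          rw [le_inv_mul_iff₀ (by positivity)]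
          calc 2 * q * outputProb (trialGam A S b' r ω) k i
              ≤ (M (trialGam A S b' r ω) k * ‖trialProjGrad A gradf S b' r i ω‖ ^ 2)
                * outputProb (trialGam A S b' r ω) k i := by gcongr
            _ = outputProb (trialGam A S b' r ω) k i * M (trialGam A S b' r ω) k
                * ‖trialProjGrad A gradf S b' r i ω‖ ^ 2 := by ring
            _ = _ := by rw [outputProb_mul_M hγ hk (Finset.mem_range.1 hi)]; rfl
        · rw [Set.indicator_of_notMem hω, mul_zero]
          exact zero_le
      · intro i _
        have : 0 < (trialState A S b' r i ω).2 := h.state_snd_pos _ _ _ i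
        positivity
    refine (lintegral_mono hpt).trans ?_
    rw [lintegral_const_mul' _ _ ENNReal.ofReal_ne_top]
    refine (mul_le_mul_right (lintegral_weightedSum_le h hrun r) _).trans (le_of_eq ?_)
    rw [← ENNReal.ofReal_mul (by positivity)]
    congr 1
    rw [← hq]
    field_simp
  refine (Finset.prod_le_prod' fun r _ => hone r).trans (le_of_eq ?_)
  rw [Finset.prod_const, Finset.card_univ, Fintype.card_fin, ENNReal.ofReal_pow (by norm_num)]

/-- Large deviations of the post-optimization gradient estimate at the output of a trial. -/
lemma measure_postErr_ge_le (hlight : HasLightTail μ A.X A.G gradf σ) (hK : 1 ≤ K) {lam : ℝ}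
    (hlam : 0 ≤ lam) (r : Fin R) :
    P {ω | 3 / 2 * (1 + lam) * σ / √(K : ℝ) ≤ ‖postErr A gradf S b' r (ρ r ω) ω‖}
      ≤ ENNReal.ofReal (Real.exp (-(lam ^ 2 / 3))) := by
  set c := 3 / 2 * (1 + lam) * σ / √(K : ℝ) with hc
  have hK0 : (0 : ℝ) < K := by exact_mod_cast hK
  have hμ : IsProbabilityMeasure μ := hrun.sample_law (.post ⟨0, hK⟩) ▸
    Measure.isProbabilityMeasure_map (hrun.sample_measurable _).aemeasurable
  have hleS := fun I => sampleSigma_le hrun.sample_measurable (I := I)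
  -- deviations at a fixed point
  have hfix : ∀ x ∈ A.X, P {ω | c ≤ ‖(K : ℝ)⁻¹ • ∑ j : Fin K, A.G x (S (.post j) ω) - gradf x‖}
      ≤ ENNReal.ofReal (Real.exp (-(lam ^ 2 / 3))) := by
    intro x hx
    have hgm : Measurable fun ξ => A.G x ξ - gradf x :=
      (h.unbiased.measurable x hx).sub measurable_const
    have hcomp : ∀ {q : Ξ → ℝ}, Integrable q μ → ∀ j : Fin K,
        Integrable (fun ω => q (S (.post j) ω)) P ∧
          ∫ ω, q (S (.post j) ω) ∂P = ∫ ξ, q ξ ∂μ := fun hq j =>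
      ⟨integrable_sample (S := fun _ => S (.post j)) (fun _ => hrun.sample_measurable _)
        (fun _ => hrun.sample_law _) hq 0,
        integral_sample (S := fun _ => S (.post j)) (fun _ => hrun.sample_measurable _)
        (fun _ => hrun.sample_law _) hq 0⟩
    have hgi : Integrable (fun ξ => A.G x ξ - gradf x) μ :=
      (h.unbiased.integrable x hx).sub (integrable_const _)
    have hdev := measure_norm_sum_ge_le (P := P)
      (ζ := fun (j : Fin K) ω => A.G x (S (.post j) ω) - gradf x)
      (fun j => hgm.comp (hrun.sample_measurable _))
      ((hrun.sample_indep.precomp (g := fun j : Fin K => Label.post j)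
        fun a b hab => by simpa using hab).comp (fun _ ξ => A.G x ξ - gradf x) fun _ => hgm)
      (fun j => integrable_sample (S := fun _ => S (.post j)) (fun _ => hrun.sample_measurable _)
        (fun _ => hrun.sample_law _) hgi 0)
      (fun j => by
        rw [integral_sample (S := fun _ => S (.post j)) (fun _ => hrun.sample_measurable _)
          (fun _ => hrun.sample_law _) hgi 0, integral_sub (h.unbiased.integrable x hx)
          (integrable_const _), h.unbiased.mean x hx]
        simp) h.variance.pos
      (fun j => (hcomp (h.variance.integrable x hx) j).1)
      (fun j => (hcomp (h.variance.integrable x hx) j).2.trans_le (h.variance.variance_le x hx))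
      (fun j => (hcomp (hlight.integrable x hx) j).1)
      (fun j => (hcomp (hlight.integrable x hx) j).2.trans_le (hlight.mean_le x hx))
      Finset.univ ⟨⟨0, hK⟩, Finset.mem_univ _⟩ hlam
    refine (measure_mono fun ω hω => ?_).trans hdev
    have hω' : c ≤ ‖(K : ℝ)⁻¹ • ∑ j : Fin K, A.G x (S (.post j) ω) - gradf x‖ := hω
    have e : (K : ℝ)⁻¹ • ∑ j : Fin K, A.G x (S (.post j) ω) - gradf x
        = (K : ℝ)⁻¹ • ∑ j : Fin K, (A.G x (S (.post j) ω) - gradf x) := by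
      rw [Finset.sum_sub_distrib, smul_sub, Finset.sum_const, Finset.card_univ, Fintype.card_fin,
        ← Nat.cast_smul_eq_nsmul ℝ, smul_smul, inv_mul_cancel₀ hK0.ne', one_smul]
    rw [e, norm_smul, Real.norm_of_nonneg (by positivity), le_inv_mul_iff₀ hK0] at hω'
    refine le_trans (le_of_eq ?_) hω'
    rw [Finset.card_univ, Fintype.card_fin, hc]
    have : √(K : ℝ) * √(K : ℝ) = K := Real.mul_self_sqrt hK0.le
    field_simp
    rw [sq, this]
  let C : Fin R → ℕ → Set Ω := fun q i =>
    if q = r then {ω | c ≤ ‖postErr A gradf S b' r i ω‖} else Set.univ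
  have hst : ∀ i, Measurable[sampleSigma S (ofTrial r)] (trialState A S b' r i) := fun i =>
    (measurable_trialState h hrun r i).mono (sampleSigma_mono (upTo_subset_ofTrial r i)) le_rfl
  have hpost : ∀ i, Measurable[sampleSigma S Set.univ] (postErr A gradf S b' r i) := fun i => by
    have hst' : Measurable[sampleSigma S Set.univ] (trialState A S b' r i) :=
      (hst i).mono (sampleSigma_mono (Set.subset_univ _)) le_rfl
    have hsum : Measurable[sampleSigma S Set.univ] fun ω =>
        ∑ j : Fin K, A.G (trialState A S b' r i ω).1 (S (.post j) ω) :=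
      @Finset.measurable_fun_sum _ _ _ _ _ _ (sampleSigma S Set.univ) _ _ fun j _ =>
        h.measurable_G_comp hst'.fst (fun ω => trialState_mem h r i ω)
          (measurable_sample (Set.mem_univ _))
    exact (hsum.const_smul ((K : ℝ)⁻¹)).sub (measurable_comp_continuousOn h.gradf_continuousOn
      hst'.fst (fun ω => trialState_mem h r i ω))
  have hCr : ∀ i, MeasurableSet[sampleSigma S Set.univ] {ω | c ≤ ‖postErr A gradf S b' r i ω‖} :=
    fun i => (measurable_norm.comp (hpost i)) measurableSet_Ici
  have hC : ∀ q i, MeasurableSet[sampleSigma S Set.univ] (C q i) := fun q i => by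
    simp only [C]
    split_ifs
    · exact hCr i
    · exact MeasurableSet.univ
  have hsum1 : ∀ q ω, ∑ i ∈ Finset.range k,
      ENNReal.ofReal (outputProb (trialGam A S b' q ω) k i) ≤ 1 := fun q ω => by
    rw [← ENNReal.ofReal_sum_of_nonneg fun i _ => outputProb_nonneg (trialGam_pos h q ω) i]
    exact ENNReal.ofReal_le_one.2 sum_outputProb_le_one
  have hsub : {ω | c ≤ ‖postErr A gradf S b' r (ρ r ω) ω‖} ⊆ {ω | ∀ q, ω ∈ C q (ρ q ω)} := by
    intro ω hω q
    simp only [C]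
    split_ifs with hq
    · subst hq; exact hω
    · trivial
  refine (measure_mono hsub).trans ((measure_index_le h hrun hC).trans ?_)
  have hpt : ∀ ω, ∏ q, ∑ i ∈ Finset.range k,
      ENNReal.ofReal (outputProb (trialGam A S b' q ω) k i) * (C q i).indicator 1 ω
      ≤ ∑ i ∈ Finset.range k, ENNReal.ofReal (outputProb (trialGam A S b' r ω) k i)
        * {ω | c ≤ ‖postErr A gradf S b' r i ω‖}.indicator 1 ω := by
    intro ω
    rw [← Finset.mul_prod_erase _ _ (Finset.mem_univ r)]
    have h1 : ∏ q ∈ Finset.univ.erase r, ∑ i ∈ Finset.range k,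
        ENNReal.ofReal (outputProb (trialGam A S b' q ω) k i) * (C q i).indicator 1 ω ≤ 1 := by
      refine Finset.prod_le_one' fun q _ => (Finset.sum_le_sum fun i _ => ?_).trans (hsum1 q ω)
      exact mul_le_of_le_one_right zero_le
        (Set.indicator_le_self' (fun _ _ => zero_le) ω)
    refine (mul_le_of_le_one_right zero_le h1).trans (le_of_eq ?_)
    simp only [C, if_true]
  refine (lintegral_mono hpt).trans ?_
  have hopm : ∀ i, Measurable fun ω => ENNReal.ofReal (outputProb (trialGam A S b' r ω) k i) :=
    fun i => ((measurable_outputProb h hrun r i).mono (hleS _) le_rfl).ennreal_ofReal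
  have hindm : ∀ i, Measurable fun ω => ENNReal.ofReal (outputProb (trialGam A S b' r ω) k i)
      * {ω | c ≤ ‖postErr A gradf S b' r i ω‖}.indicator 1 ω := fun i =>
    (hopm i).mul (measurable_one.indicator (hleS _ _ (hCr i)))
  rw [lintegral_finsetSum _ fun i _ => hindm i]
  have hterm : ∀ i, ∫⁻ ω, ENNReal.ofReal (outputProb (trialGam A S b' r ω) k i)
      * {ω | c ≤ ‖postErr A gradf S b' r i ω‖}.indicator 1 ω ∂P
      ≤ (∫⁻ ω, ENNReal.ofReal (outputProb (trialGam A S b' r ω) k i) ∂P)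
        * ENNReal.ofReal (Real.exp (-(lam ^ 2 / 3))) := by
    intro i
    -- the post-optimization samples are independent of the trial
    let U : Ω → A.X × ENNReal := fun ω => (⟨(trialState A S b' r i ω).1, trialState_mem h r i ω⟩,
      ENNReal.ofReal (outputProb (trialGam A S b' r ω) k i))
    let Y : Ω → Fin K → Ξ := fun ω j => S (.post j) ω
    let T : Set (A.X × (Fin K → Ξ)) :=
      {p | c ≤ ‖(K : ℝ)⁻¹ • ∑ j : Fin K, A.G p.1 (p.2 j) - gradf p.1‖}
    have hT : MeasurableSet T := by
      have m1 : Measurable fun p : A.X × (Fin K → Ξ) => (p.1 : E) := by fun_prop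
      refine measurableSet_le measurable_const (Measurable.norm (Measurable.sub ?_
        (measurable_comp_continuousOn h.gradf_continuousOn m1 fun p => p.1.2)))
      exact (Finset.measurable_fun_sum _ fun j _ => h.measurable_G_comp m1 (fun p => p.1.2)
        (by fun_prop)).const_smul ((K : ℝ)⁻¹)
    let ψ : (A.X × ENNReal) × (Fin K → Ξ) → ENNReal := fun p =>
      p.1.2 * T.indicator 1 (p.1.1, p.2)
    have hψ : Measurable ψ := (by fun_prop : Measurable fun p : (A.X × ENNReal) × (Fin K → Ξ) =>
      p.1.2).mul ((measurable_one.indicator hT).comp (by fun_prop))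
    have hUm : Measurable[sampleSigma S (ofTrial r)] U :=
      ((hst i).fst.subtype_mk (h := fun ω => trialState_mem h r i ω)).prodMk
        (measurable_outputProb h hrun r i).ennreal_ofReal
    have hYm : Measurable[sampleSigma S {l | ∃ j, l = .post j}] Y :=
      measurable_pi_sample fun j => ⟨j, rfl⟩
    have hdisj : Disjoint (ofTrial r : Set (Label R K)) {l | ∃ j, l = .post j} := by
      rw [Set.disjoint_left]
      rintro l (⟨u, j, rfl⟩ | ⟨u, j, rfl⟩) ⟨j', hj'⟩ <;> simp at hj'
    have e := lintegral_indepFun_eq (hUm.mono (hleS _) le_rfl) (hYm.mono (hleS _) le_rfl)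
      (indepFun_of_disjoint hrun.sample_measurable hrun.sample_indep hdisj hUm hYm) hψ
    refine (le_of_eq e).trans ?_
    rw [← lintegral_mul_const _ (hopm i)]
    refine lintegral_mono fun ω => ?_
    have hx := trialState_mem h (S := S) (b' := b') r i ω
    have hYm' : Measurable fun ω' => ((U ω).1, Y ω') :=
      measurable_const.prodMk (hYm.mono (hleS _) le_rfl)
    simp only [ψ]
    rw [lintegral_const_mul' _ _ ENNReal.ofReal_ne_top]
    refine mul_le_mul_right ?_ _
    have e2 : (fun ω' => T.indicator (1 : A.X × (Fin K → Ξ) → ENNReal) ((U ω).1, Y ω'))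
        = ((fun ω' => ((U ω).1, Y ω')) ⁻¹' T).indicator 1 := rfl
    rw [e2, lintegral_indicator_one (hYm' hT)]
    exact hfix _ hx
  refine (Finset.sum_le_sum fun i _ => hterm i).trans ?_
  rw [← Finset.sum_mul, ← lintegral_finsetSum _ fun i _ => hopm i]
  refine mul_le_of_le_one_left zero_le ?_
  calc _ ≤ ∫⁻ _, 1 ∂P := lintegral_mono fun ω => hsum1 r ω
    _ = 1 := by simp

/-- The deviation bound for every confidence parameter `lam`. -/
lemma le_measureReal_exactProjGrad [IsProbabilityMeasure μ]
    (hlight : HasLightTail μ A.X A.G gradf σ) (hk : 2 ≤ k) (hK : 1 ≤ K) {lam : ℝ}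
    (hlam : 0 ≤ lam) :
    1 - (1 / 2 : ℝ) ^ R - (R : ℝ) * Real.exp (-(lam ^ 2 / 3)) ≤
      P.real {ω | ‖exactProjGrad A gradf S b' ρ (sel ω) ω‖ ^ 2 ≤
        8 * Q A.rule k Lhat (Metric.diam A.X) σ A.L₀ / (⨅ r, M (trialGam A S b' r ω) k)
          + 12 * (1 + lam) ^ 2 * σ ^ 2 / (K : ℝ)} := by
  set q := Q A.rule k Lhat (Metric.diam A.X) σ A.L₀ with hq
  set c := 3 / 2 * (1 + lam) * σ / √(K : ℝ) with hc
  have hK0 : (0 : ℝ) < K := by exact_mod_cast hK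
  have hc2 : 16 / 3 * c ^ 2 = 12 * (1 + lam) ^ 2 * σ ^ 2 / (K : ℝ) := by
    rw [hc, div_pow, Real.sq_sqrt hK0.le]; ring
  set good := {ω | ‖exactProjGrad A gradf S b' ρ (sel ω) ω‖ ^ 2 ≤
        8 * q / (⨅ r, M (trialGam A S b' r ω) k) + 12 * (1 + lam) ^ 2 * σ ^ 2 / (K : ℝ)}
  set bad1 := {ω | ∀ r, 2 * q
        < M (trialGam A S b' r ω) k * ‖trialProjGrad A gradf S b' r (ρ r ω) ω‖ ^ 2}
  set bad2 : Fin R → Set Ω := fun r => {ω | c ≤ ‖postErr A gradf S b' r (ρ r ω) ω‖}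
  -- the selection need not be measurable, but the failure event is covered by two bad events
  have hcover : (Set.univ : Set Ω) ⊆ good ∪ (bad1 ∪ ⋃ r, bad2 r) := by
    intro ω _
    by_cases h1 : ω ∈ bad1
    · exact Or.inr (Or.inl h1)
    by_cases h2 : ω ∈ ⋃ r, bad2 r
    · exact Or.inr (Or.inr h2)
    left
    simp only [bad1, Set.mem_ofPred_eq, not_forall, not_lt] at h1
    obtain ⟨r, hr⟩ := h1
    simp only [bad2, Set.mem_iUnion, Set.mem_ofPred_eq, not_exists, not_le] at h2
    have := norm_exactProjGrad_sq_le h hrun hk hr (fun r => (h2 r).le)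
    rw [hc2] at this
    exact this
  have h1 := measure_forall_lt_le h hrun hk
  have h2 := fun r => measure_postErr_ge_le h hrun hlight hK hlam r
  have r1 : P.real bad1 ≤ (1 / 2) ^ R := ENNReal.toReal_le_of_le_ofReal (by positivity) h1
  have r2 : ∀ r, P.real (bad2 r) ≤ Real.exp (-(lam ^ 2 / 3)) := fun r =>
    ENNReal.toReal_le_of_le_ofReal (by positivity) (h2 r)
  have r3 : P.real (⋃ r, bad2 r) ≤ (R : ℝ) * Real.exp (-(lam ^ 2 / 3)) :=
    (measureReal_iUnion_fintype_le _).trans ((Finset.sum_le_sum fun r _ => r2 r).trans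
      (by simp))
  have r4 : (1 : ℝ) ≤ P.real good + (P.real bad1 + P.real (⋃ r, bad2 r)) := by
    calc (1 : ℝ) = P.real Set.univ := by simp
      _ ≤ P.real (good ∪ (bad1 ∪ ⋃ r, bad2 r)) := measureReal_mono hcover
      _ ≤ _ := (measureReal_union_le _ _).trans (by gcongr; exact measureReal_union_le _ _)
  linarith

end TwoPhase

section Constants

lemma log_two_ge : (0.69 : ℝ) ≤ Real.log 2 := by
  have := Real.log_two_gt_d9; linarith

/-- The number of trials is at most `2 / δ`. -/
lemma ceil_logb_le {δ : ℝ} (hδ : 0 < δ) (hδ' : δ ≤ 1 / 2) :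
    (⌈Real.logb 2 (2 / δ)⌉₊ : ℝ) ≤ 2 / δ := by
  set y := 2 / δ with hy
  have hy4 : 4 ≤ y := by rw [hy, le_div_iff₀ hδ]; linarith
  clear_value y
  have hl2 := log_two_ge
  have h1 : Real.log y ≤ y / 4 - 1 + 2 * Real.log 2 := by
    have e : Real.log y = Real.log (y / 4) + 2 * Real.log 2 := by
      rw [Real.log_div (by positivity) (by norm_num), show (4 : ℝ) = 2 ^ 2 by norm_num,
        Real.log_pow]
      push_cast; ring
    have := Real.log_le_sub_one_of_pos (show 0 < y / 4 by positivity)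
    linarith
  have h2 : Real.logb 2 y ≤ y - 1 := by
    rw [Real.logb, div_le_iff₀ (by linarith)]
    nlinarith
  have h3 : 0 ≤ Real.logb 2 y := Real.logb_nonneg one_lt_two (by linarith)
  have := (Nat.ceil_lt_add_one h3).le
  linarith

/-- The factor of `σ² / K` in the confidence bound is of the order of `log (1 / δ)`. -/
lemma confidence_factor_le {δ : ℝ} (hδ : 0 < δ) (hδ' : δ ≤ 1 / 2) :
    12 * (1 + √(3 * Real.log (2 * (⌈Real.logb 2 (2 / δ)⌉₊ : ℝ) / δ))) ^ 2
      ≤ 324 * Real.log (1 / δ) := by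
  set N := (⌈Real.logb 2 (2 / δ)⌉₊ : ℝ) with hN
  have hN1 : 1 ≤ N := by
    have : 0 < Real.logb 2 (2 / δ) :=
      Real.logb_pos one_lt_two (by rw [lt_div_iff₀ hδ]; linarith)
    rw [hN]
    exact_mod_cast Nat.ceil_pos.2 this
  have hl2 := log_two_ge
  have hΛ : Real.log 2 ≤ Real.log (1 / δ) :=
    Real.log_le_log two_pos (by rw [le_div_iff₀ hδ]; linarith)
  set Λ := Real.log (1 / δ) with hΛdef
  have h1 : Real.log (2 * N / δ) ≤ 4 * Λ := by
    have h2 : 2 * N / δ ≤ 4 * (1 / δ) ^ 2 := by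
      have := ceil_logb_le hδ hδ'
      calc 2 * N / δ ≤ 2 * (2 / δ) / δ := by gcongr
        _ = _ := by field_simp; ring
    refine (Real.log_le_log (by positivity) h2).trans ?_
    rw [Real.log_mul (by norm_num) (by positivity), Real.log_pow,
      show (4 : ℝ) = 2 ^ 2 by norm_num, Real.log_pow]
    push_cast
    linarith
  have h0 : 0 ≤ Real.log (2 * N / δ) :=
    Real.log_nonneg (by rw [le_div_iff₀ hδ]; nlinarith)
  have hs := Real.sq_sqrt (show 0 ≤ 3 * Real.log (2 * N / δ) by positivity)
  set s := √(3 * Real.log (2 * N / δ))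
  nlinarith [sq_nonneg (s - 1)]

end Constants

end ACSPG

theorem mainTheorem6 {n : ℕ} {Ξ Ω : Type*} [MeasurableSpace Ξ] [MeasurableSpace Ω]
    (μ : Measure Ξ) [IsProbabilityMeasure μ] (P : Measure Ω) [IsProbabilityMeasure P]
    (A : ACSPG.Input (EuclideanSpace ℝ (Fin n)) Ξ)
    (f : EuclideanSpace ℝ (Fin n) → ℝ)
    (gradf : EuclideanSpace ℝ (Fin n) → EuclideanSpace ℝ (Fin n))
    (L l σ Lhat Lbar : ℝ)
    (hX_compact : IsCompact A.X) (hX_convex : Convex ℝ A.X)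
    (hf : ACSPG.IsSmoothWeaklyConvex A.X f gradf L l)
    (h_unbiased : ACSPG.IsUnbiased μ A.X A.G gradf)
    (h_variance : ACSPG.HasBoundedVariance μ A.X A.G gradf σ)
    (h_smooth : ACSPG.IsSmoothStochastic μ A.X f A.F A.G Lhat Lbar)
    (h_light : ACSPG.HasLightTail μ A.X A.G gradf σ)
    (hx₀ : A.x₀ ∈ A.X) (hL₀ : 0 < A.L₀) (hL₀_le : A.L₀ ≤ Lhat) (h_rule : A.rule.Valid)
    (R k K : ℕ) (hR : 1 ≤ R) (hk : 2 ≤ k) (hK : 1 ≤ K)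
    (S : ACSPG.Label R K → Ω → Ξ) (b' : Fin R → ℕ → Ω → ℕ) (ρ : Fin R → Ω → ℕ)
    (sel : Ω → Fin R)
    (h_run : ACSPG.IsTwoPhaseRun μ P A k S b' ρ sel) :
    (∀ lam : ℝ, 0 ≤ lam →
      1 - (1 / 2 : ℝ) ^ R - (R : ℝ) * Real.exp (-(lam ^ 2 / 3)) ≤
        P.real {ω | ‖ACSPG.exactProjGrad A gradf S b' ρ (sel ω) ω‖ ^ 2 ≤
          8 * ACSPG.Q A.rule k Lhat (Metric.diam A.X) σ A.L₀
              / (⨅ r, ACSPG.M (ACSPG.trialGam A S b' r ω) k)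
            + 12 * (1 + lam) ^ 2 * σ ^ 2 / (K : ℝ)}) ∧
    (∀ δ : ℝ, 0 < δ → δ < 1 → R = ⌈Real.logb 2 (2 / δ)⌉₊ →
      1 - δ ≤
        P.real {ω | ‖ACSPG.exactProjGrad A gradf S b' ρ (sel ω) ω‖ ^ 2 ≤
          8 * ACSPG.Q A.rule k Lhat (Metric.diam A.X) σ A.L₀
              / (⨅ r, ACSPG.M (ACSPG.trialGam A S b' r ω) k)
            + 12 * (1 + √(3 * Real.log (2 * (⌈Real.logb 2 (2 / δ)⌉₊ : ℝ) / δ))) ^ 2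
              * (σ ^ 2 / (K : ℝ))}) ∧
    (∃ C : ℝ, 0 < C ∧ ∀ (δ ε τ : ℝ) (N : ℕ), 0 < δ → δ ≤ 1 / 2 → 0 < ε → 0 < τ →
      C * τ ^ 2 * Real.log (1 / δ) / ε ^ 2 ≤ (N : ℝ) →
        12 * (1 + √(3 * Real.log (2 * (⌈Real.logb 2 (2 / δ)⌉₊ : ℝ) / δ))) ^ 2
          * (τ ^ 2 / (N : ℝ)) ≤ ε ^ 2) := by
  have hS : ACSPG.Setting μ A f gradf σ Lhat Lbar :=
    { compact := hX_compact
      convex := hX_convex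
      hasGradient := hf.hasGradient
      gradf_continuousOn := by
        refine (LipschitzOnWith.of_dist_le_mul (K := ⟨L, hf.l_nonneg.trans hf.l_le⟩)
          fun x hx y hy => ?_).continuousOn
        rw [dist_eq_norm, dist_eq_norm]
        exact hf.lipschitz x hx y hy
      unbiased := h_unbiased
      variance := h_variance
      smooth := h_smooth
      x₀_mem := hx₀
      L₀_pos := hL₀
      L₀_le := hL₀_le
      valid := h_rule }
  refine ⟨fun lam hlam => ACSPG.le_measureReal_exactProjGrad hS h_run h_light hk hK hlam, ?_,
    324, by norm_num, ?_⟩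
  · intro δ hδ hδ1 hRδ
    have hR1 : (1 : ℝ) ≤ R := by exact_mod_cast hR
    have hpos : 0 ≤ Real.log (2 * (R : ℝ) / δ) :=
      Real.log_nonneg (by rw [le_div_iff₀ hδ]; linarith)
    rw [← hRδ]
    have hmain := ACSPG.le_measureReal_exactProjGrad hS h_run h_light hk hK
      (lam := √(3 * Real.log (2 * (R : ℝ) / δ))) (Real.sqrt_nonneg _)
    have e1 : (R : ℝ) * Real.exp (-(√(3 * Real.log (2 * (R : ℝ) / δ)) ^ 2 / 3)) = δ / 2 := by
      rw [Real.sq_sqrt (by positivity), mul_div_cancel_left₀ _ (by norm_num : (3 : ℝ) ≠ 0),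
        Real.exp_neg, Real.exp_log (by positivity)]
      field_simp
    have e2 : (1 / 2 : ℝ) ^ R ≤ δ / 2 := by
      have h1 : Real.logb 2 (2 / δ) ≤ R := by rw [hRδ]; exact Nat.le_ceil _
      rw [Real.logb_le_iff_le_rpow one_lt_two (by positivity), Real.rpow_natCast] at h1
      rw [one_div, inv_pow, inv_le_comm₀ (by positivity) (by positivity), inv_div]
      exact h1
    rw [e1] at hmain
    simp only [mul_div_assoc] at hmain ⊢
    linarith
  · intro δ ε τ N hδ hδ' hε hτ hN
    have hlog : 0 < Real.log (1 / δ) := Real.log_pos (by rw [lt_div_iff₀ hδ]; linarith)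
    have hN0 : (0 : ℝ) < N := lt_of_lt_of_le (by positivity) hN
    rw [div_le_iff₀ (by positivity)] at hN
    calc _ ≤ 324 * Real.log (1 / δ) * (τ ^ 2 / (N : ℝ)) := by
          exact mul_le_mul_of_nonneg_right (ACSPG.confidence_factor_le hδ hδ') (by positivity)
      _ ≤ ε ^ 2 := by
          rw [mul_div_assoc', div_le_iff₀ hN0]
          linarith
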